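/- Theorem (guarding the free space of isothetic rectangles). Let $k\ge 1$ and let $R_1,\dots,R_k$ be pairwise disjoint closed nondegenerate rectangles in the plane whose sides are parallel to the coordinate axes. The free space is $F=\mathbb{R}^2\setminus\bigcup_i \operatorname{int} R_i$. A vertex guard with $180^\circ$ vision is placed at a vertex $v$ of one of the rectangles and faces one of the four directions $d\in\{(1,0),(-1,0),(0,1),(0,-1)\}$ (East, West, North, South); it sees a point $p$ if $p$ lies in the closed half-plane $\{p:\langle p-v,d\rangle\ge 0\}$ in front of it and the line segment $vp$ is contained in $F$. Several guards may stand at the same vertex, facing different directions. Then $2k+\lfloor k/4\rfloor+4$ vertex guards with $180^\circ$ vision are always sufficient to guard the free space: there is a set of at most $2k+\lfloor k/4\rfloor+4$ such guards such that every point of $F$ is seen by at least one of them. -/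

import Mathlib

namespace FreeSpaceGuarding

/-- A (nondegenerate) isothetic rectangle in the plane: its sides are parallel to the
coordinate axes. -/
structure IsoRect where
  left : ℝ
  right : ℝ
  bottom : ℝ
  top : ℝ
  left_lt_right : left < right
  bottom_lt_top : bottom < top

namespace IsoRect

/-- The closed rectangle as a set of points of the plane. -/
def carrier (R : IsoRect) : Set (ℝ × ℝ) :=
  Set.Icc R.left R.right ×ˢ Set.Icc R.bottom R.top

/-- The four vertices of the rectangle. -/
def vertices (R : IsoRect) : Set (ℝ × ℝ) :=
  {(R.left, R.bottom), (R.left, R.top), (R.right, R.bottom), (R.right, R.top)}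

end IsoRect

/-- The free space of a family of rectangles: the plane without the interiors of the rectangles
(so the boundaries of the rectangles belong to the free space). -/
def freeSpace {ι : Type*} (R : ι → IsoRect) : Set (ℝ × ℝ) :=
  {p | ∀ i, p ∉ interior (R i).carrier}

/-- The four directions in which a guard can face. -/
inductive Direction where
  | east
  | west
  | north
  | south

/-- The unit vector of a direction. -/
def Direction.vec : Direction → ℝ × ℝ
  | .east => (1, 0)
  | .west => (-1, 0)
  | .north => (0, 1)
  | .south => (0, -1)

/-- A guard with `180°` vision: a position in the plane and the direction it faces. -/
structure Guard where
  pos : ℝ × ℝ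
  dir : Direction

namespace Guard

/-- The range of vision of a guard: the closed half-plane in front of it, bounded by the line
through its position perpendicular to the direction it faces. -/
def fieldOfVision (g : Guard) : Set (ℝ × ℝ) :=
  {p | 0 ≤ (p.1 - g.pos.1) * g.dir.vec.1 + (p.2 - g.pos.2) * g.dir.vec.2}

/-- The guard sees the point `p`: `p` is in its range of vision, and the line segment from the
guard to `p` lies completely within the free space. -/
def Sees {ι : Type*} (R : ι → IsoRect) (g : Guard) (p : ℝ × ℝ) : Prop :=
  p ∈ g.fieldOfVision ∧ segment ℝ g.pos p ⊆ freeSpace R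

/-- The guard is a vertex guard: it stands at a vertex of one of the rectangles. -/
def IsVertexGuard {ι : Type*} (R : ι → IsoRect) (g : Guard) : Prop :=
  ∃ i, g.pos ∈ (R i).vertices

end Guard

/-- A finite set of guards guards the free space if each of its points is seen by some guard. -/
def GuardsFreeSpace {ι : Type*} (R : ι → IsoRect) (G : Finset Guard) : Prop :=
  ∀ p ∈ freeSpace R, ∃ g ∈ G, g.Sees R p

end FreeSpaceGuarding

/-! Shrink the rectangles slightly so that they are in general position inside a large square, and
cut the free part of the square into cells by extending every horizontal side until it hits a
rectangle or the border. A cell is determined by what bounds it from above: the border, or one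
rectangle in one of three positions. So there are at most `3k + 1` cells (`exists_finset_isCell`),
and a single guard sees each of them (`IsCell.exists_guard`).

To save guards, let one guard serve two cells. At a vertex, the extended horizontal side separates
the cell beyond that side from a cell beside the rectangle. If a vertex on the opposite side of the
first cell is suitably placed, a guard there sees both cells; the given vertex is then good
(`Good.exists_guard`). Matching the `2k` horizontal sides with good vertices, cell by cell, loses at
most one at the top border and one at the bottom border, so there are at least `2k - 2` good
vertices (`two_mul_card_le`).

Call two good vertices adjacent if they share a cell. A cell serves at most two good vertices
(`Inc.eq_or_eq_or_eq`), so degrees are at most two; a triangle would need three cells each touching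
the others across a horizontal line, so there is none. Hence some independent set `I` contains two
fifths of the good vertices (`exists_independent`). One guard per pair in `I` and one per remaining
cell make at most `3k + 1 - (4k - 4)/5 = (11k + 9)/5` guards, which is within the bound.

Finally let the shrinking tend to zero. There are only finitely many choices of vertices and
directions, so one choice works for arbitrarily small shrinkings. Not seeing a point is an open
condition, so that choice works for the original rectangles. -/

namespace FreeSpaceGuarding

/-! ### Arrangements in general position, their cells and their symmetries -/

/-- A family of pairwise disjoint rectangles in general position, inside the open square of
half-width `M`. -/
structure Arrangement (ι : Type*) where
  l : ι → ℝ
  r : ι → ℝ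
  b : ι → ℝ
  t : ι → ℝ
  M : ℝ
  l_lt_r : ∀ i, l i < r i
  b_lt_t : ∀ i, b i < t i
  disj : ∀ i j, i ≠ j → r i < l j ∨ r j < l i ∨ t i < b j ∨ t j < b i
  l_inj : Function.Injective l
  r_inj : Function.Injective r
  b_inj : Function.Injective b
  t_inj : Function.Injective t
  t_ne_b : ∀ i j, t i ≠ b j
  lt_l : ∀ i, -M < l i
  r_lt : ∀ i, r i < M
  lt_b : ∀ i, -M < b i
  t_lt : ∀ i, t i < M

/-- A box in the plane, given by the coordinates of its sides. -/
@[ext] structure Box where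
  l : ℝ
  r : ℝ
  b : ℝ
  t : ℝ

namespace Box

/-- Mirror image in the vertical axis. -/
def flipX (c : Box) : Box := ⟨-c.r, -c.l, c.b, c.t⟩

/-- Mirror image in the horizontal axis. -/
def flipY (c : Box) : Box := ⟨c.l, c.r, -c.t, -c.b⟩

@[simp] lemma flipX_flipX (c : Box) : c.flipX.flipX = c := by simp [flipX]

@[simp] lemma flipY_flipY (c : Box) : c.flipY.flipY = c := by simp [flipY]

/-- The points of a box. -/
def carrier (c : Box) : Set (ℝ × ℝ) := Set.Icc c.l c.r ×ˢ Set.Icc c.b c.t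

end Box

namespace Arrangement

variable {ι : Type*} (K : Arrangement ι)

/-- Mirror image in the vertical axis. -/
def flipX : Arrangement ι where
  l i := -K.r i
  r i := -K.l i
  b := K.b
  t := K.t
  M := K.M
  l_lt_r i := neg_lt_neg (K.l_lt_r i)
  b_lt_t := K.b_lt_t
  disj i j h := by
    rcases K.disj i j h with h | h | h | h
    · exact Or.inr (Or.inl (neg_lt_neg h))
    · exact Or.inl (neg_lt_neg h)
    · exact Or.inr (Or.inr (Or.inl h))
    · exact Or.inr (Or.inr (Or.inr h))
  l_inj _ _ h := K.r_inj (neg_injective h)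
  r_inj _ _ h := K.l_inj (neg_injective h)
  b_inj := K.b_inj
  t_inj := K.t_inj
  t_ne_b := K.t_ne_b
  lt_l i := neg_lt_neg (K.r_lt i)
  r_lt i := neg_lt.1 (K.lt_l i)
  lt_b := K.lt_b
  t_lt := K.t_lt

/-- Mirror image in the horizontal axis. -/
def flipY : Arrangement ι where
  l := K.l
  r := K.r
  b i := -K.t i
  t i := -K.b i
  M := K.M
  l_lt_r := K.l_lt_r
  b_lt_t i := neg_lt_neg (K.b_lt_t i)
  disj i j h := by
    rcases K.disj i j h with h | h | h | h
    · exact Or.inl h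
    · exact Or.inr (Or.inl h)
    · exact Or.inr (Or.inr (Or.inr (neg_lt_neg h)))
    · exact Or.inr (Or.inr (Or.inl (neg_lt_neg h)))
  l_inj := K.l_inj
  r_inj := K.r_inj
  b_inj _ _ h := K.t_inj (neg_injective h)
  t_inj _ _ h := K.b_inj (neg_injective h)
  t_ne_b i j h := K.t_ne_b j i (neg_injective h).symm
  lt_l := K.lt_l
  r_lt := K.r_lt
  lt_b i := neg_lt_neg (K.t_lt i)
  t_lt i := neg_lt.1 (K.lt_b i)

/-- The rectangles of an arrangement. -/
def rect (i : ι) : IsoRect := ⟨K.l i, K.r i, K.b i, K.t i, K.l_lt_r i, K.b_lt_t i⟩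

/-- The box overlaps no rectangle. -/
def IsFree (c : Box) : Prop := ∀ i, K.r i ≤ c.l ∨ c.r ≤ K.l i ∨ K.t i ≤ c.b ∨ c.t ≤ K.b i

/-- The rectangle `i` is the left wall of the box `c`, and its top side is level with the top
of `c`. -/
def TopL (c : Box) (i : ι) : Prop := K.r i = c.l ∧ K.t i = c.t ∧ K.b i ≤ c.b

/-- The rectangle `i` is the right wall of `c`, and its top side is level with the top of `c`. -/
def TopR (c : Box) (i : ι) : Prop := K.l i = c.r ∧ K.t i = c.t ∧ K.b i ≤ c.b

/-- The bottom side of the rectangle `i` lies on the top side of `c`. -/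
def TopF (c : Box) (i : ι) : Prop := K.b i = c.t ∧ c.l < K.l i ∧ K.r i < c.r

/-- The rectangle `i` is the left wall of `c`, and its bottom side is level with the bottom
of `c`. -/
def BotL (c : Box) (i : ι) : Prop := K.r i = c.l ∧ K.b i = c.b ∧ c.t ≤ K.t i

/-- The rectangle `i` is the right wall of `c`, and its bottom side is level with the bottom
of `c`. -/
def BotR (c : Box) (i : ι) : Prop := K.l i = c.r ∧ K.b i = c.b ∧ c.t ≤ K.t i

/-- The top side of the rectangle `i` lies on the bottom side of `c`. -/
def BotF (c : Box) (i : ι) : Prop := K.t i = c.b ∧ c.l < K.l i ∧ K.r i < c.r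

/-- The cells of the decomposition of the free part of the square that arises when all horizontal
sides are extended until they meet another rectangle or the boundary of the square. -/
structure IsCell (c : Box) : Prop where
  l_lt_r : c.l < c.r
  b_lt_t : c.b < c.t
  le_l : -K.M ≤ c.l
  r_le : c.r ≤ K.M
  le_b : -K.M ≤ c.b
  t_le : c.t ≤ K.M
  free : K.IsFree c
  -- A wall has to span the full height of the cell. This forces cuts at the ends of walls and makes
  -- overlapping cells equal.
  left : c.l = -K.M ∨ ∃ i, K.r i = c.l ∧ K.b i ≤ c.b ∧ c.t ≤ K.t i
  right : c.r = K.M ∨ ∃ i, K.l i = c.r ∧ K.b i ≤ c.b ∧ c.t ≤ K.t i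
  top : c.t = K.M ∨ (∃ i, K.TopL c i) ∨ (∃ i, K.TopR c i) ∨ ∃ i, K.TopF c i
  bot : c.b = -K.M ∨ (∃ i, K.BotL c i) ∨ (∃ i, K.BotR c i) ∨ ∃ i, K.BotF c i

variable {K}

lemma topF_flipX {c : Box} {i : ι} : K.flipX.TopF c.flipX i ↔ K.TopF c i := by
  simp only [TopF, flipX, Box.flipX, neg_lt_neg_iff]; tauto

lemma botF_flipX {c : Box} {i : ι} : K.flipX.BotF c.flipX i ↔ K.BotF c i := by
  simp only [BotF, flipX, Box.flipX, neg_lt_neg_iff]; tauto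

lemma topL_flipX {c : Box} {i : ι} : K.flipX.TopL c.flipX i ↔ K.TopR c i := by
  simp only [TopL, TopR, flipX, Box.flipX, neg_inj]

lemma topR_flipX {c : Box} {i : ι} : K.flipX.TopR c.flipX i ↔ K.TopL c i := by
  simp only [TopL, TopR, flipX, Box.flipX, neg_inj]

lemma botL_flipX {c : Box} {i : ι} : K.flipX.BotL c.flipX i ↔ K.BotR c i := by
  simp only [BotL, BotR, flipX, Box.flipX, neg_inj]

lemma botR_flipX {c : Box} {i : ι} : K.flipX.BotR c.flipX i ↔ K.BotL c i := by
  simp only [BotL, BotR, flipX, Box.flipX, neg_inj]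

lemma topF_flipY {c : Box} {i : ι} : K.flipY.TopF c.flipY i ↔ K.BotF c i := by
  simp only [TopF, BotF, flipY, Box.flipY, neg_inj]

lemma botF_flipY {c : Box} {i : ι} : K.flipY.BotF c.flipY i ↔ K.TopF c i := by
  simp only [TopF, BotF, flipY, Box.flipY, neg_inj]

lemma topL_flipY {c : Box} {i : ι} : K.flipY.TopL c.flipY i ↔ K.BotL c i := by
  simp only [TopL, BotL, flipY, Box.flipY, neg_inj, neg_le_neg_iff]

lemma topR_flipY {c : Box} {i : ι} : K.flipY.TopR c.flipY i ↔ K.BotR c i := by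
  simp only [TopR, BotR, flipY, Box.flipY, neg_inj, neg_le_neg_iff]

lemma botL_flipY {c : Box} {i : ι} : K.flipY.BotL c.flipY i ↔ K.TopL c i := by
  simp only [TopL, BotL, flipY, Box.flipY, neg_inj, neg_le_neg_iff]

lemma botR_flipY {c : Box} {i : ι} : K.flipY.BotR c.flipY i ↔ K.TopR c i := by
  simp only [TopR, BotR, flipY, Box.flipY, neg_inj, neg_le_neg_iff]

lemma IsCell.flipX {c : Box} (h : K.IsCell c) : K.flipX.IsCell c.flipX where
  l_lt_r := neg_lt_neg h.l_lt_r
  b_lt_t := h.b_lt_t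
  le_l := neg_le_neg h.r_le
  r_le := neg_le.1 h.le_l
  le_b := h.le_b
  t_le := h.t_le
  free i := by
    rcases h.free i with h | h | h | h
    · exact Or.inr (Or.inl (neg_le_neg h))
    · exact Or.inl (neg_le_neg h)
    · exact Or.inr (Or.inr (Or.inl h))
    · exact Or.inr (Or.inr (Or.inr h))
  left := h.right.imp (fun h => congrArg _ h) fun ⟨i, h, h'⟩ => ⟨i, congrArg _ h, h'⟩
  right := h.left.imp (fun h => neg_eq_iff_eq_neg.2 h) fun ⟨i, h, h'⟩ => ⟨i, congrArg _ h, h'⟩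
  top := by simp only [topF_flipX, topL_flipX, topR_flipX]; have := h.top; tauto
  bot := by simp only [botF_flipX, botL_flipX, botR_flipX]; have := h.bot; tauto

lemma IsCell.flipY {c : Box} (h : K.IsCell c) : K.flipY.IsCell c.flipY where
  l_lt_r := h.l_lt_r
  b_lt_t := neg_lt_neg h.b_lt_t
  le_l := h.le_l
  r_le := h.r_le
  le_b := neg_le_neg h.t_le
  t_le := neg_le.1 h.le_b
  free i := by
    rcases h.free i with h | h | h | h
    · exact Or.inl h
    · exact Or.inr (Or.inl h)
    · exact Or.inr (Or.inr (Or.inr (neg_le_neg h)))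
    · exact Or.inr (Or.inr (Or.inl (neg_le_neg h)))
  left := h.left.imp id fun ⟨i, h, h₁, h₂⟩ => ⟨i, h, neg_le_neg h₂, neg_le_neg h₁⟩
  right := h.right.imp id fun ⟨i, h, h₁, h₂⟩ => ⟨i, h, neg_le_neg h₂, neg_le_neg h₁⟩
  top := by
    simp only [topF_flipY, topL_flipY, topR_flipY]
    exact h.bot.imp (fun h => neg_eq_iff_eq_neg.2 h) id
  bot := by
    simp only [botF_flipY, botL_flipY, botR_flipY]
    exact h.top.imp (fun h => congrArg _ h) id

@[simp] lemma flipX_flipX : K.flipX.flipX = K := by cases K; simp [Arrangement.flipX]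

@[simp] lemma flipY_flipY : K.flipY.flipY = K := by cases K; simp [Arrangement.flipY]

lemma IsCell.of_flipX {c : Box} (h : K.flipX.IsCell c) : K.IsCell c.flipX := by
  simpa using h.flipX

lemma IsCell.of_flipY {c : Box} (h : K.flipY.IsCell c) : K.IsCell c.flipY := by
  simpa using h.flipY

end Arrangement

end FreeSpaceGuarding

/-! ### Existence and uniqueness of cells -/

namespace FreeSpaceGuarding
namespace Arrangement

variable {ι : Type*} {K : Arrangement ι}

/-- A rectangle level with the top or bottom of `c` has a height within the range of the wall, so
reaching to the left of the wall's face would make it meet the wall. This gives the strict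
inequalities in `TopF` and `BotF`. -/
lemma lt_l_of_wall {c : Box} (hbt : c.b < c.t)
    (hl : c.l = -K.M ∨ ∃ i, K.r i = c.l ∧ K.b i ≤ c.b ∧ c.t ≤ K.t i) {i : ι}
    (hi : K.b i = c.t ∨ K.t i = c.b) (h : c.l < K.r i) : c.l < K.l i := by
  rcases hl with hl | ⟨j, hj, hb, ht⟩
  · exact hl ▸ K.lt_l i
  · have hij : i ≠ j := by rintro rfl; rcases hi with hi | hi <;> linarith
    have := K.l_lt_r j
    have := K.b_lt_t i
    rcases K.disj i j hij with h' | h' | h' | h' <;> rcases hi with hi | hi <;> linarith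

lemma r_lt_of_wall {c : Box} (hbt : c.b < c.t)
    (hr : c.r = K.M ∨ ∃ i, K.l i = c.r ∧ K.b i ≤ c.b ∧ c.t ≤ K.t i) {i : ι}
    (hi : K.b i = c.t ∨ K.t i = c.b) (h : K.l i < c.r) : K.r i < c.r := by
  rcases hr with hr | ⟨j, hj, hb, ht⟩
  · exact hr ▸ K.r_lt i
  · have hij : i ≠ j := by rintro rfl; rcases hi with hi | hi <;> linarith
    have := K.l_lt_r j
    have := K.b_lt_t i
    rcases K.disj i j hij with h' | h' | h' | h' <;> rcases hi with hi | hi <;> linarith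

/-- A point in general position lies in a cell. -/
lemma exists_isCell [Finite ι] {x y : ℝ} (hx : -K.M < x) (hx' : x < K.M) (hy : -K.M < y)
    (hy' : y < K.M) (hb : ∀ i, K.b i ≠ y) (ht : ∀ i, K.t i ≠ y)
    (hxy : ∀ i, K.b i < y → y < K.t i → K.r i < x ∨ x < K.l i) :
    ∃ c, K.IsCell c ∧ c.l < x ∧ x < c.r ∧ c.b < y ∧ y < c.t := by
  -- The horizontal rays from the point find the two walls. The segment between them is then moved
  -- up and down until a wall ends or a rectangle blocks it.
  obtain ⟨l, hl, hlmax⟩ := Set.exists_max_image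
    (insert (-K.M) (K.r '' {i | K.b i < y ∧ y < K.t i ∧ K.r i < x})) id (Set.toFinite _) ⟨_, Or.inl rfl⟩
  obtain ⟨r, hr, hrmin⟩ := Set.exists_min_image
    (insert K.M (K.l '' {i | K.b i < y ∧ y < K.t i ∧ x < K.l i})) id (Set.toFinite _) ⟨_, Or.inl rfl⟩
  obtain ⟨t, ht₀, htmin⟩ := Set.exists_min_image
    (insert K.M (K.t '' {i | K.b i < y ∧ y < K.t i ∧ (K.r i = l ∨ K.l i = r)}) ∪
      K.b '' {i | y < K.b i ∧ K.l i < r ∧ l < K.r i}) id (Set.toFinite _) ⟨_, Or.inl (Or.inl rfl)⟩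
  obtain ⟨b, hb₀, hbmax⟩ := Set.exists_max_image
    (insert (-K.M) (K.b '' {i | K.b i < y ∧ y < K.t i ∧ (K.r i = l ∨ K.l i = r)}) ∪
      K.t '' {i | K.t i < y ∧ K.l i < r ∧ l < K.r i}) id (Set.toFinite _) ⟨_, Or.inl (Or.inl rfl)⟩
  simp only [Set.mem_insert_iff, Set.mem_union, Set.mem_image, Set.mem_ofPred_eq, id] at *
  have hMl : -K.M ≤ l := hlmax _ (Or.inl rfl)
  have hrM : r ≤ K.M := hrmin _ (Or.inl rfl)
  have htM : t ≤ K.M := htmin _ (Or.inl (Or.inl rfl))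
  have hMb : -K.M ≤ b := hbmax _ (Or.inl (Or.inl rfl))
  have hlx : l < x := by rcases hl with rfl | ⟨i, hi, rfl⟩; exacts [hx, hi.2.2]
  have hxr : x < r := by rcases hr with rfl | ⟨i, hi, rfl⟩; exacts [hx', hi.2.2]
  have hyt : y < t := by
    rcases ht₀ with (rfl | ⟨i, hi, rfl⟩) | ⟨i, hi, rfl⟩; exacts [hy', hi.2.1, hi.1]
  have hby : b < y := by
    rcases hb₀ with (rfl | ⟨i, hi, rfl⟩) | ⟨i, hi, rfl⟩; exacts [hy, hi.1, hi.1]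
  have hleft : l = -K.M ∨ ∃ i, K.r i = l ∧ K.b i ≤ b ∧ t ≤ K.t i := by
    rcases hl with h | ⟨i, ⟨h₁, h₂, h₃⟩, h⟩
    · exact Or.inl h
    · exact Or.inr ⟨i, h, hbmax _ (Or.inl (Or.inr ⟨i, ⟨h₁, h₂, Or.inl h⟩, rfl⟩)),
        htmin _ (Or.inl (Or.inr ⟨i, ⟨h₁, h₂, Or.inl h⟩, rfl⟩))⟩
  have hright : r = K.M ∨ ∃ i, K.l i = r ∧ K.b i ≤ b ∧ t ≤ K.t i := by
    rcases hr with h | ⟨i, ⟨h₁, h₂, h₃⟩, h⟩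
    · exact Or.inl h
    · exact Or.inr ⟨i, h, hbmax _ (Or.inl (Or.inr ⟨i, ⟨h₁, h₂, Or.inr h⟩, rfl⟩)),
        htmin _ (Or.inl (Or.inr ⟨i, ⟨h₁, h₂, Or.inr h⟩, rfl⟩))⟩
  refine ⟨⟨l, r, b, t⟩, ⟨hlx.trans hxr, hby.trans hyt, hMl, hrM, hMb, htM, ?_, hleft, hright, ?_, ?_⟩,
    hlx, hxr, hby, hyt⟩
  · intro i
    by_contra! h
    obtain ⟨h₁, h₂, h₃, h₄⟩ := h
    simp only at h₁ h₂ h₃ h₄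
    rcases lt_or_gt_of_ne (hb i) with hbi | hbi
    · rcases lt_or_gt_of_ne (ht i) with hti | hti
      · exact h₃.not_ge (hbmax _ (Or.inr ⟨i, ⟨hti, h₂, h₁⟩, rfl⟩))
      · rcases hxy i hbi hti with h | h
        · exact h₁.not_ge (hlmax _ (Or.inr ⟨i, ⟨hbi, hti, h⟩, rfl⟩))
        · exact h₂.not_ge (hrmin _ (Or.inr ⟨i, ⟨hbi, hti, h⟩, rfl⟩))
    · exact h₄.not_ge (htmin _ (Or.inr ⟨i, ⟨hbi, h₂, h₁⟩, rfl⟩))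
  · rcases ht₀ with (h | ⟨i, ⟨h₁, h₂, h₃ | h₃⟩, h⟩) | ⟨i, ⟨h₁, h₂, h₃⟩, h⟩
    · exact Or.inl h
    · exact Or.inr (Or.inl ⟨i, h₃, h, hbmax _ (Or.inl (Or.inr ⟨i, ⟨h₁, h₂, Or.inl h₃⟩, rfl⟩))⟩)
    · exact Or.inr (Or.inr (Or.inl
        ⟨i, h₃, h, hbmax _ (Or.inl (Or.inr ⟨i, ⟨h₁, h₂, Or.inr h₃⟩, rfl⟩))⟩))
    · exact Or.inr (Or.inr (Or.inr ⟨i, h,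
        lt_l_of_wall (c := ⟨l, r, b, t⟩) (hby.trans hyt) hleft (Or.inl h) h₃,
        r_lt_of_wall (c := ⟨l, r, b, t⟩) (hby.trans hyt) hright (Or.inl h) h₂⟩))
  · rcases hb₀ with (h | ⟨i, ⟨h₁, h₂, h₃ | h₃⟩, h⟩) | ⟨i, ⟨h₁, h₂, h₃⟩, h⟩
    · exact Or.inl h
    · exact Or.inr (Or.inl ⟨i, h₃, h, htmin _ (Or.inl (Or.inr ⟨i, ⟨h₁, h₂, Or.inl h₃⟩, rfl⟩))⟩)
    · exact Or.inr (Or.inr (Or.inl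
        ⟨i, h₃, h, htmin _ (Or.inl (Or.inr ⟨i, ⟨h₁, h₂, Or.inr h₃⟩, rfl⟩))⟩))
    · exact Or.inr (Or.inr (Or.inr ⟨i, h,
        lt_l_of_wall (c := ⟨l, r, b, t⟩) (hby.trans hyt) hleft (Or.inr h) h₃,
        r_lt_of_wall (c := ⟨l, r, b, t⟩) (hby.trans hyt) hright (Or.inr h) h₂⟩))

/-- Otherwise the left wall of `d`, or the border of the square, would reach into `c`. -/
lemma IsCell.l_le_of_overlap {c d : Box} (hc : K.IsCell c) (hd : K.IsCell d) (h₂ : d.l < c.r)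
    (h₃ : c.b < d.t) (h₄ : d.b < c.t) : d.l ≤ c.l := by
  by_contra! h
  rcases hd.left with hl | ⟨i, hi, hb, ht⟩
  · linarith [hc.le_l]
  · have := K.l_lt_r i
    rcases hc.free i with h' | h' | h' | h' <;> linarith

/-- If `d` rose higher, whatever stops `c` would conflict with `d`: a wall ending there would touch
the different wall of `d` that continues past it, and a rectangle resting on `c` would cut into `d`.
-/
lemma IsCell.t_le_of_overlap {c d : Box} (hc : K.IsCell c) (hd : K.IsCell d) (hl : c.l = d.l)
    (hr : c.r = d.r) (h₄ : d.b < c.t) : d.t ≤ c.t := by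
  by_contra! h
  have := hc.b_lt_t
  have := hd.b_lt_t
  have := hc.l_lt_r
  rcases hc.top with ht | ⟨i, h₁, h₂, h₃⟩ | ⟨i, h₁, h₂, h₃⟩ | ⟨i, h₁, h₂, h₃⟩
  · linarith [hd.t_le]
  · rcases hd.left with hw | ⟨j, hj, hb, ht⟩
    · linarith [K.l_lt_r i, K.lt_l i]
    · have hij : i ≠ j := by rintro rfl; linarith
      have := K.l_lt_r i
      have := K.l_lt_r j
      rcases K.disj i j hij with h' | h' | h' | h' <;> linarith
  · rcases hd.right with hw | ⟨j, hj, hb, ht⟩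
    · linarith [K.l_lt_r i, K.r_lt i]
    · have hij : i ≠ j := by rintro rfl; linarith
      have := K.l_lt_r i
      have := K.l_lt_r j
      rcases K.disj i j hij with h' | h' | h' | h' <;> linarith
  · have := K.b_lt_t i
    have := K.l_lt_r i
    rcases hd.free i with h' | h' | h' | h' <;> linarith

/-- Different cells do not overlap. -/
lemma IsCell.eq_of_overlap {c d : Box} (hc : K.IsCell c) (hd : K.IsCell d) (h₁ : c.l < d.r)
    (h₂ : d.l < c.r) (h₃ : c.b < d.t) (h₄ : d.b < c.t) : c = d := by
  have hl : c.l = d.l :=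
    le_antisymm (hd.l_le_of_overlap hc h₁ h₄ h₃) (hc.l_le_of_overlap hd h₂ h₃ h₄)
  have hr : c.r = d.r := neg_injective <| le_antisymm
    (hd.flipX.l_le_of_overlap hc.flipX (neg_lt_neg h₂) h₄ h₃)
    (hc.flipX.l_le_of_overlap hd.flipX (neg_lt_neg h₁) h₃ h₄)
  have ht : c.t = d.t :=
    le_antisymm (hd.t_le_of_overlap hc hl.symm hr.symm h₃) (hc.t_le_of_overlap hd hl hr h₄)
  have hb : c.b = d.b := neg_injective <| le_antisymm
    (hd.flipY.t_le_of_overlap hc.flipY hl.symm hr.symm (neg_lt_neg h₄))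
    (hc.flipY.t_le_of_overlap hd.flipY hl hr (neg_lt_neg h₃))
  exact Box.ext hl hr hb ht

/-- Supplies a height just below `v`, past every other coordinate below `v`. -/
lemma exists_lt_forall_lt {S : Set ℝ} (hS : S.Finite) (v : ℝ) :
    ∃ y < v, ∀ s ∈ S, s < v → s < y := by
  obtain ⟨m, hm, hmax⟩ := Set.exists_max_image (insert (v - 1) (S ∩ Set.Iio v)) id
    ((hS.subset Set.inter_subset_left).insert _) ⟨_, Or.inl rfl⟩
  have hmv : m < v := by rcases hm with rfl | h; exacts [by linarith, h.2]
  obtain ⟨y, h₁, h₂⟩ := exists_between hmv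
  exact ⟨y, h₂, fun s hs hsv => (hmax s (Or.inr ⟨hs, hsv⟩)).trans_lt h₁⟩

/-- Above every rectangle there is a cell. -/
lemma exists_botF [Finite ι] (i : ι) : ∃ c, K.IsCell c ∧ K.BotF c i := by
  -- With all coordinates negated, the gap below `-K.t i` becomes a gap above `K.t i`; the sample
  -- point has height `-y`.
  obtain ⟨y, hy, hgap⟩ := exists_lt_forall_lt
    (S := insert (-K.M) (Set.range (fun j => -K.b j) ∪ Set.range (fun j => -K.t j)))
    (Set.toFinite _) (-K.t i)
  have hgM : -K.M < y := hgap _ (Or.inl rfl) (neg_lt_neg (K.t_lt i))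
  have hgb : ∀ j, K.t i < K.b j → -y < K.b j := fun j h => neg_lt.1 <|
    hgap _ (Or.inr (Or.inl ⟨j, rfl⟩)) (neg_lt_neg h)
  have hgt : ∀ j, K.t i < K.t j → -y < K.t j := fun j h => neg_lt.1 <|
    hgap _ (Or.inr (Or.inr ⟨j, rfl⟩)) (neg_lt_neg h)
  have hi := K.b_lt_t i
  have hi' := K.l_lt_r i
  obtain ⟨c, hc, h₁, h₂, h₃, h₄⟩ := K.exists_isCell (x := K.l i) (y := -y) (K.lt_l i)
    (hi'.trans (K.r_lt i)) (by linarith [K.lt_b i]) (by linarith)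
    (fun j hj => by
      have := hgb j
      grind)
    (fun j hj => by
      have := hgt j
      grind)
    (fun j hj hj' => by
      by_contra! h
      have hbj : K.b j < K.t i := lt_of_le_of_ne
        (not_lt.1 fun h => (hgb j h).not_gt hj) (K.t_ne_b i j).symm
      have hij : i ≠ j := by rintro rfl; linarith
      rcases K.disj i j hij with h' | h' | h' | h' <;> linarith)
  have hcb : c.b = K.t i := by
    apply le_antisymm
    · rcases hc.bot with hb | ⟨j, -, hb, -⟩ | ⟨j, -, hb, -⟩ | ⟨j, hb, -⟩
      · linarith [K.lt_b i]
      · exact not_lt.1 fun h => by linarith [hgb j (by linarith)]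
      · exact not_lt.1 fun h => by linarith [hgb j (by linarith)]
      · exact not_lt.1 fun h => by linarith [hgt j (by linarith)]
    · rcases hc.free i with h' | h' | h' | h' <;> linarith
  exact ⟨c, hc, hcb.symm, h₁, r_lt_of_wall hc.b_lt_t hc.right (Or.inr hcb.symm) h₂⟩

/-- Below every rectangle there is a cell. -/
lemma exists_topF [Finite ι] (i : ι) : ∃ c, K.IsCell c ∧ K.TopF c i := by
  obtain ⟨c, hc, hci⟩ := K.flipY.exists_botF i
  exact ⟨c.flipY, hc.of_flipY, by rw [← botF_flipY]; simpa using hci⟩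

/-- Under the left extension of the top side of a rectangle there is a cell. -/
lemma exists_topR [Finite ι] {c : Box} (hc : K.IsCell c) {i : ι} (hi : K.BotF c i) :
    ∃ d, K.IsCell d ∧ K.TopR d i ∧ d.l = c.l := by
  obtain ⟨hib, hil, hir⟩ := hi
  obtain ⟨y, hy, hgap⟩ := exists_lt_forall_lt
    (S := insert (-K.M) (Set.range K.b ∪ Set.range K.t)) (Set.toFinite _) (K.t i)
  have hgM : -K.M < y := hgap _ (Or.inl rfl) ((K.lt_b i).trans (K.b_lt_t i))
  have hgb : ∀ j, K.b j < K.t i → K.b j < y := fun j h => hgap _ (Or.inr (Or.inl ⟨j, rfl⟩)) h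
  have hgt : ∀ j, K.t j < K.t i → K.t j < y := fun j h => hgap _ (Or.inr (Or.inr ⟨j, rfl⟩)) h
  have hbi := K.b_lt_t i
  have hlr := K.l_lt_r i
  -- A rectangle other than `i` that is met at height `y` crosses the line of the top side of `i`.
  -- Below the range of `c` it would therefore cut into `c`; this pins the side walls of the new
  -- cell.
  have htop : ∀ j, y < K.t j → j = i ∨ K.t i < K.t j := fun j hj => by
    rcases lt_trichotomy (K.t i) (K.t j) with h | h | h
    · exact Or.inr h
    · exact Or.inl (K.t_inj h).symm
    · exact absurd (hgt j h) hj.not_gt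
  have hcbt := hc.b_lt_t
  obtain ⟨x, hx, hx'⟩ := exists_between hil
  obtain ⟨d, hd, h₁, h₂, h₃, h₄⟩ := K.exists_isCell (x := x) (y := y) (by linarith [hc.le_l])
    (by linarith [K.r_lt i]) hgM (by linarith [K.t_lt i])
    (fun j hj => by
      have := hgb j
      grind)
    (fun j hj => by
      have := hgt j
      grind)
    (fun j hj hj' => by
      by_contra! h
      rcases htop j hj' with rfl | ht
      · linarith
      · rcases hc.free j with h' | h' | h' | h' <;> linarith)
  have hdr' : d.r ≤ K.l i := by
    have := hgb i hbi
    rcases hd.free i with h' | h' | h' | h' <;> linarith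
  have hwall : K.l i = d.r ∧ K.b i ≤ d.b ∧ d.t ≤ K.t i := by
    rcases hd.right with hr | ⟨j, hj, hb, ht⟩
    · linarith [K.r_lt i]
    · rcases htop j (by linarith) with rfl | ht'
      · exact ⟨hj, hb, ht⟩
      · have := K.l_lt_r j
        rcases hc.free j with h' | h' | h' | h' <;> linarith
  have hdt : d.t = K.t i := by
    refine le_antisymm hwall.2.2 (not_lt.1 fun h => ?_)
    rcases hd.top with ht | ⟨j, -, ht, -⟩ | ⟨j, -, ht, -⟩ | ⟨j, ht, -⟩
    · linarith [K.t_lt i]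
    · linarith [hgt j (by linarith)]
    · linarith [hgt j (by linarith)]
    · linarith [hgb j (by linarith)]
  refine ⟨d, hd, ⟨hwall.1, hdt.symm, hwall.2.1⟩, le_antisymm ?_ ?_⟩
  · by_contra! h
    rcases hd.left with hl | ⟨j, hj, hb, ht⟩
    · linarith [hc.le_l]
    · have := K.l_lt_r j
      rcases htop j (by linarith) with rfl | ht'
      · linarith
      · rcases hc.free j with h' | h' | h' | h' <;> linarith
  · by_contra! h
    rcases hc.left with hl | ⟨j, hj, hb, ht⟩
    · linarith [hd.le_l]
    · have := K.l_lt_r j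
      have : K.b j < y := hgb j (lt_of_le_of_ne (by linarith) (K.t_ne_b i j).symm)
      rcases hd.free j with h' | h' | h' | h' <;> linarith

/-- Under the right extension of the top side of a rectangle there is a cell. -/
lemma exists_topL [Finite ι] {c : Box} (hc : K.IsCell c) {i : ι} (hi : K.BotF c i) :
    ∃ d, K.IsCell d ∧ K.TopL d i ∧ d.r = c.r := by
  obtain ⟨d, hd, hdi, hl⟩ := K.flipX.exists_topR hc.flipX (botF_flipX.2 hi)
  exact ⟨d.flipX, hd.of_flipX, by rw [← topR_flipX]; simpa using hdi, neg_eq_iff_eq_neg.2 hl⟩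

/-- Above the left extension of the bottom side of a rectangle there is a cell. -/
lemma exists_botR [Finite ι] {c : Box} (hc : K.IsCell c) {i : ι} (hi : K.TopF c i) :
    ∃ d, K.IsCell d ∧ K.BotR d i ∧ d.l = c.l := by
  obtain ⟨d, hd, hdi, hl⟩ := K.flipY.exists_topR hc.flipY (botF_flipY.2 hi)
  exact ⟨d.flipY, hd.of_flipY, by rw [← topR_flipY]; simpa using hdi, hl⟩

/-- Above the right extension of the bottom side of a rectangle there is a cell. -/
lemma exists_botL [Finite ι] {c : Box} (hc : K.IsCell c) {i : ι} (hi : K.TopF c i) :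
    ∃ d, K.IsCell d ∧ K.BotL d i ∧ d.r = c.r := by
  obtain ⟨d, hd, hdi, hl⟩ := K.flipY.exists_topL hc.flipY (botF_flipY.2 hi)
  exact ⟨d.flipY, hd.of_flipY, by rw [← topL_flipY]; simpa using hdi, hl⟩

end Arrangement
end FreeSpaceGuarding

/-! ### Guards for one cell and for two neighbouring cells -/

namespace FreeSpaceGuarding

/-- Needed for the pigeonhole over guard sets in the limit argument. -/
instance : Finite Direction :=
  Finite.of_injective
    (fun d : Direction => match d with
      | .east => (0 : Fin 4)
      | .west => 1
      | .north => 2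
      | .south => 3)
    (by rintro (_ | _ | _ | _) (_ | _ | _ | _) h <;> first | rfl | cases h)

lemma IsoRect.interior_carrier (R : IsoRect) :
    interior R.carrier = Set.Ioo R.left R.right ×ˢ Set.Ioo R.bottom R.top := by
  rw [carrier, interior_prod_eq, interior_Icc, interior_Icc]

/-- The vertex of a rectangle on its right or left and on its top or bottom side. -/
def IsoRect.vertex (R : IsoRect) (right top : Bool) : ℝ × ℝ :=
  (if right then R.right else R.left, if top then R.top else R.bottom)

/-- The guard at a vertex of the rectangle `i` of a family, facing a given direction. -/
def vertexGuard {ι : Type*} (R : ι → IsoRect) (g : (ι × Bool × Bool) × Direction) : Guard :=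
  ⟨(R g.1.1).vertex g.1.2.1 g.1.2.2, g.2⟩

lemma isVertexGuard_vertexGuard {ι : Type*} (R : ι → IsoRect)
    (g : (ι × Bool × Bool) × Direction) : (vertexGuard R g).IsVertexGuard R := by
  obtain ⟨⟨i, _ | _, _ | _⟩, d⟩ := g <;>
    exact ⟨i, by simp [vertexGuard, IsoRect.vertex, IsoRect.vertices]⟩

namespace Arrangement

variable {ι : Type*} {K : Arrangement ι}

/-- A guard in a free box sees every point of the box that it faces. -/
lemma IsFree.sees {c : Box} (hc : K.IsFree c) {g : Guard} (hg : g.pos ∈ c.carrier) {p : ℝ × ℝ}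
    (hp : p ∈ c.carrier) (h : p ∈ g.fieldOfVision) : g.Sees K.rect p := by
  refine ⟨h, fun q hq i hi => ?_⟩
  have hq' : q ∈ c.carrier := ((convex_Icc c.l c.r).prod (convex_Icc c.b c.t)).segment_subset hg hp hq
  rw [IsoRect.interior_carrier] at hi
  obtain ⟨⟨h₁, h₂⟩, h₃, h₄⟩ := hi
  obtain ⟨⟨h₅, h₆⟩, h₇, h₈⟩ := hq'
  simp only [rect] at h₁ h₂ h₃ h₄
  rcases hc i with h' | h' | h' | h' <;> linarith

/-- Every cell is seen by a single guard. -/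
lemma IsCell.exists_guard [Nonempty ι] {c : Box} (hc : K.IsCell c) :
    ∃ g, ∀ p ∈ c.carrier, (vertexGuard K.rect g).Sees K.rect p := by
  have hlr := hc.l_lt_r
  have hbt := hc.b_lt_t
  rcases hc.top with ht | ⟨i, h₁, h₂, h₃⟩ | ⟨i, h₁, h₂, h₃⟩ | ⟨i, h₁, h₂, h₃⟩
  · have hl : c.l = -K.M := hc.left.resolve_right fun ⟨i, _, _, h⟩ => by linarith [K.t_lt i]
    have hr : c.r = K.M := hc.right.resolve_right fun ⟨i, _, _, h⟩ => by linarith [K.t_lt i]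
    rcases hc.bot with hb | ⟨i, -, -, h⟩ | ⟨i, -, -, h⟩ | ⟨i, h₁, h₂, h₃⟩
    -- A cell that is the whole square would contain a rectangle.
    · have i := Classical.arbitrary ι
      have := K.b_lt_t i
      have := K.l_lt_r i
      rcases hc.free i with h | h | h | h <;>
        linarith [K.lt_l i, K.r_lt i, K.lt_b i, K.t_lt i]
    · linarith [K.t_lt i]
    · linarith [K.t_lt i]
    · have := K.l_lt_r i
      refine ⟨((i, false, true), .north), fun p hp => hc.free.sees ?_ hp ?_⟩
      · constructor <;> constructor <;> simp [vertexGuard, IsoRect.vertex, rect] <;> linarith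
      · have := hp.2.1
        simp [Guard.fieldOfVision, vertexGuard, IsoRect.vertex, rect, Direction.vec]; linarith
  · refine ⟨((i, true, true), .east), fun p hp => hc.free.sees ?_ hp ?_⟩
    · constructor <;> constructor <;> simp [vertexGuard, IsoRect.vertex, rect] <;> linarith
    · have := hp.1.1
      simp [Guard.fieldOfVision, vertexGuard, IsoRect.vertex, rect, Direction.vec]; linarith
  · refine ⟨((i, false, true), .west), fun p hp => hc.free.sees ?_ hp ?_⟩
    · constructor <;> constructor <;> simp [vertexGuard, IsoRect.vertex, rect] <;> linarith
    · have := hp.1.2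
      simp [Guard.fieldOfVision, vertexGuard, IsoRect.vertex, rect, Direction.vec]; linarith
  · have := K.l_lt_r i
    refine ⟨((i, false, false), .south), fun p hp => hc.free.sees ?_ hp ?_⟩
    · constructor <;> constructor <;> simp [vertexGuard, IsoRect.vertex, rect] <;> linarith
    · have := hp.2.2
      simp [Guard.fieldOfVision, vertexGuard, IsoRect.vertex, rect, Direction.vec]; linarith

variable (K) in
/-- The top (or bottom) side of the rectangle `i` lies on the boundary of `c`. -/
def Flat (c : Box) (i : ι) : Bool → Prop
  | true => K.BotF c i
  | false => K.TopF c i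

variable (K) in
/-- The vertex is a corner of `c`, and `c` lies to the side of its rectangle. -/
def Corner (c : Box) : ι × Bool × Bool → Prop
  | (i, false, true) => K.TopR c i
  | (i, true, true) => K.TopL c i
  | (i, false, false) => K.BotR c i
  | (i, true, false) => K.BotL c i

variable (K) in
/-- For a vertex on the boundary of `c` as in `Flat`: some vertex on the opposite side of `c`
sees both cells that meet in the horizontal line from the given vertex away from its rectangle. -/
def Good (c : Box) : ι × Bool × Bool → Prop
  | (i, false, true) => (∃ j, K.TopL c j) ∨ ∃ j, K.TopF c j ∧ K.l j < K.l i
  | (i, true, true) => (∃ j, K.TopR c j) ∨ ∃ j, K.TopF c j ∧ K.r i < K.r j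
  | (i, false, false) => (∃ j, K.BotL c j) ∨ ∃ j, K.BotF c j ∧ K.l j < K.l i
  | (i, true, false) => (∃ j, K.BotR c j) ∨ ∃ j, K.BotF c j ∧ K.r i < K.r j

variable (K) in
/-- The vertical sides of the two cells next to a vertex that face away from its rectangle are
aligned. -/
def Aligned (c d : Box) : Bool → Prop
  | false => d.l = c.l
  | true => d.r = c.r

lemma exists_flat [Finite ι] (i : ι) : ∀ s, ∃ c, K.IsCell c ∧ K.Flat c i s
  | true => exists_botF i
  | false => exists_topF i

lemma exists_corner [Finite ι] {c : Box} (hc : K.IsCell c) :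
    ∀ v : ι × Bool × Bool, K.Flat c v.1 v.2.2 →
      ∃ d, K.IsCell d ∧ K.Corner d v ∧ Aligned c d v.2.1
  | (_, false, true), h => exists_topR hc h
  | (_, true, true), h => exists_topL hc h
  | (_, false, false), h => exists_botR hc h
  | (_, true, false), h => exists_botL hc h

/-- The two cells next to a good vertex are seen by a single guard. -/
lemma Good.exists_guard {c d : Box} (hc : K.IsCell c) (hd : K.IsCell d) :
    ∀ v : ι × Bool × Bool, K.Good c v → K.Flat c v.1 v.2.2 → K.Corner d v → Aligned c d v.2.1 →
      ∃ g, ∀ p, p ∈ c.carrier ∨ p ∈ d.carrier → (vertexGuard K.rect g).Sees K.rect p := by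
  have hclr := hc.l_lt_r
  have hcbt := hc.b_lt_t
  have hdlr := hd.l_lt_r
  have hdbt := hd.b_lt_t
  rintro ⟨i, sx, sy⟩ hg hf hd' ha
  have hi := K.l_lt_r i
  have hx : c.l ≤ d.l ∧ d.r ≤ c.r := by
    rcases sx with _ | _ <;> rcases sy with _ | _ <;> obtain ⟨h₁, h₂, h₃⟩ := hf <;>
      obtain ⟨h₄, h₅, h₆⟩ := hd' <;> simp only [Aligned] at ha <;> simp only at h₁ h₂ h₃ <;>
      constructor <;> linarith
  have hy : d.t = c.b ∨ c.t = d.b := by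
    rcases sx with _ | _ <;> rcases sy with _ | _ <;> obtain ⟨h₁, h₂, h₃⟩ := hf <;>
      obtain ⟨h₄, h₅, h₆⟩ := hd' <;> simp only at h₁ <;>
      first | exact Or.inl (by linarith) | exact Or.inr (by linarith)
  -- The column of `d` through both cells is free: the cells meet in a horizontal line, so no
  -- rectangle fits between them. A guard in the part of the column inside `c` sees `c` within `c`,
  -- and `d` within the column.
  have hB : K.IsFree ⟨d.l, d.r, min c.b d.b, max c.t d.t⟩ := by
    intro j
    have := K.b_lt_t j
    rcases hd.free j with h | h | h | h
    · exact Or.inl h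
    · exact Or.inr (Or.inl h)
    all_goals
      rcases hc.free j with h' | h' | h' | h'
      · exact Or.inl (h'.trans hx.1)
      · exact Or.inr (Or.inl (hx.2.trans h'))
      all_goals
        first
        | exact Or.inr (Or.inr (Or.inl (le_min h' h)))
        | exact Or.inr (Or.inr (Or.inr (max_le h' h)))
        | exact Or.inr (Or.inr (hy.imp (fun hy => le_min (by linarith) (by linarith))
            fun hy => max_le (by linarith) (by linarith)))
  have key : ∀ g : (ι × Bool × Bool) × Direction,
      ((d.l ≤ (vertexGuard K.rect g).pos.1 ∧ (vertexGuard K.rect g).pos.1 ≤ d.r) ∧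
        c.b ≤ (vertexGuard K.rect g).pos.2 ∧ (vertexGuard K.rect g).pos.2 ≤ c.t) →
      (∀ x y, c.l ≤ x → x ≤ c.r → c.b ≤ y ∧ y ≤ c.t ∨ d.b ≤ y ∧ y ≤ d.t →
        (x, y) ∈ (vertexGuard K.rect g).fieldOfVision) →
      ∃ g, ∀ p, p ∈ c.carrier ∨ p ∈ d.carrier → (vertexGuard K.rect g).Sees K.rect p := by
    rintro g ⟨⟨h₁, h₂⟩, h₃, h₄⟩ hv
    refine ⟨g, ?_⟩
    rintro ⟨x, y⟩ (⟨⟨h₅, h₆⟩, h₇, h₈⟩ | ⟨⟨h₅, h₆⟩, h₇, h₈⟩)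
    · exact hc.free.sees ⟨⟨hx.1.trans h₁, h₂.trans hx.2⟩, h₃, h₄⟩ ⟨⟨h₅, h₆⟩, h₇, h₈⟩
        (hv _ _ h₅ h₆ (Or.inl ⟨h₇, h₈⟩))
    · exact hB.sees ⟨⟨h₁, h₂⟩, (min_le_left _ _).trans h₃, h₄.trans (le_max_left _ _)⟩
        ⟨⟨h₅, h₆⟩, (min_le_right _ _).trans h₇, h₈.trans (le_max_right _ _)⟩
        (hv _ _ (hx.1.trans h₅) (h₆.trans hx.2) (Or.inr ⟨h₇, h₈⟩))
  -- The guard stands at the witness of `Good`. If the witness is a wall, alignment of the outer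
  -- sides puts the guard in the column of `d`; if it is a flat rectangle, the strict inequality in
  -- `Good` does.
  rcases sx with _ | _ <;> rcases sy with _ | _ <;> obtain ⟨h₁, h₂, h₃⟩ := hf <;>
    obtain ⟨h₄, h₅, h₆⟩ := hd' <;> simp only [Aligned] at ha <;> simp only at h₁ h₂ h₃ <;>
    rcases hg with ⟨j, h₇, h₈, h₉⟩ | ⟨j, ⟨h₇, h₈, h₉⟩, h₀⟩ <;> have hj := K.l_lt_r j
  · refine key ((j, true, false), .east) ?_ fun x y hx₁ hx₂ hy => ?_ <;>
      simp [vertexGuard, IsoRect.vertex, rect, Guard.fieldOfVision, Direction.vec]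
    · refine ⟨⟨?_, ?_⟩, ?_, ?_⟩ <;> linarith
    · linarith
  · refine key ((j, false, true), .north) ?_ fun x y hx₁ hx₂ hy => ?_ <;>
      simp [vertexGuard, IsoRect.vertex, rect, Guard.fieldOfVision, Direction.vec]
    · refine ⟨⟨?_, ?_⟩, ?_, ?_⟩ <;> linarith
    · rcases hy with hy | hy <;> linarith
  · refine key ((j, true, true), .east) ?_ fun x y hx₁ hx₂ hy => ?_ <;>
      simp [vertexGuard, IsoRect.vertex, rect, Guard.fieldOfVision, Direction.vec]
    · refine ⟨⟨?_, ?_⟩, ?_, ?_⟩ <;> linarith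
    · linarith
  · refine key ((j, false, false), .south) ?_ fun x y hx₁ hx₂ hy => ?_ <;>
      simp [vertexGuard, IsoRect.vertex, rect, Guard.fieldOfVision, Direction.vec]
    · refine ⟨⟨?_, ?_⟩, ?_, ?_⟩ <;> linarith
    · rcases hy with hy | hy <;> linarith
  · refine key ((j, false, false), .west) ?_ fun x y hx₁ hx₂ hy => ?_ <;>
      simp [vertexGuard, IsoRect.vertex, rect, Guard.fieldOfVision, Direction.vec]
    · refine ⟨⟨?_, ?_⟩, ?_, ?_⟩ <;> linarith
    · linarith
  · refine key ((j, true, true), .north) ?_ fun x y hx₁ hx₂ hy => ?_ <;>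
      simp [vertexGuard, IsoRect.vertex, rect, Guard.fieldOfVision, Direction.vec]
    · refine ⟨⟨?_, ?_⟩, ?_, ?_⟩ <;> linarith
    · rcases hy with hy | hy <;> linarith
  · refine key ((j, false, true), .west) ?_ fun x y hx₁ hx₂ hy => ?_ <;>
      simp [vertexGuard, IsoRect.vertex, rect, Guard.fieldOfVision, Direction.vec]
    · refine ⟨⟨?_, ?_⟩, ?_, ?_⟩ <;> linarith
    · linarith
  · refine key ((j, true, false), .south) ?_ fun x y hx₁ hx₂ hy => ?_ <;>
      simp [vertexGuard, IsoRect.vertex, rect, Guard.fieldOfVision, Direction.vec]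
    · refine ⟨⟨?_, ?_⟩, ?_, ?_⟩ <;> linarith
    · rcases hy with hy | hy <;> linarith

end Arrangement
end FreeSpaceGuarding

/-! ### Independent sets in triangle-free graphs of degree at most two -/

namespace FreeSpaceGuarding

/-- A triangle-free graph of maximum degree at most two has an independent set containing two
fifths of its vertices. -/
lemma exists_independent {α : Type*} [DecidableEq α] (adj : α → α → Prop)
    (symm : ∀ a b, adj a b → adj b a) (irrefl : ∀ a, ¬ adj a a)
    (triangle : ∀ a b c, adj a b → adj a c → adj b c → False)
    (s : Finset α) (deg : ∀ a ∈ s, ∀ b ∈ s, ∀ c ∈ s, ∀ d ∈ s, adj a b → adj a c → adj a d →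
      b = c ∨ b = d ∨ c = d) :
    ∃ I ⊆ s, (∀ a ∈ I, ∀ b ∈ I, ¬ adj a b) ∧ 2 * s.card ≤ 5 * I.card := by
  classical
  induction s using Finset.strongInduction with
  | H s ih =>
  -- Greedy step: put `A` into the independent set, discard `N`, which contains `A` and its
  -- neighbours, and recurse.
  have step : ∀ A N : Finset α, A ⊆ s → A.Nonempty → (∀ a ∈ A, ∀ b ∈ A, ¬ adj a b) → A ⊆ N →
      (∀ a ∈ A, ∀ b ∈ s, adj a b → b ∈ N) → 2 * N.card ≤ 5 * A.card →
      ∃ I ⊆ s, (∀ a ∈ I, ∀ b ∈ I, ¬ adj a b) ∧ 2 * s.card ≤ 5 * I.card := by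
    intro A N hAs hA hind hAN hN hcard
    obtain ⟨a, ha⟩ := hA
    obtain ⟨I, hI, hI', hc⟩ := ih (s \ N)
      (Finset.ssubset_iff_of_subset Finset.sdiff_subset |>.2 ⟨a, hAs ha, by simp [hAN ha]⟩)
      (fun a ha b hb c hc d hd => deg a (Finset.sdiff_subset ha) b (Finset.sdiff_subset hb)
        c (Finset.sdiff_subset hc) d (Finset.sdiff_subset hd))
    have hI₁ : ∀ b ∈ I, b ∈ s ∧ b ∉ N := fun b hb => Finset.mem_sdiff.1 (hI hb)
    refine ⟨A ∪ I, Finset.union_subset hAs (hI.trans Finset.sdiff_subset), ?_, ?_⟩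
    · intro a ha b hb hab
      rcases Finset.mem_union.1 ha with ha | ha <;> rcases Finset.mem_union.1 hb with hb | hb
      · exact hind a ha b hb hab
      · exact (hI₁ b hb).2 (hN a ha b (hI₁ b hb).1 hab)
      · exact (hI₁ a ha).2 (hN b hb a (hI₁ a ha).1 (symm _ _ hab))
      · exact hI' a ha b hb hab
    · have hd : Disjoint A I := Finset.disjoint_left.2 fun x hx hx' => (hI₁ x hx').2 (hAN hx)
      rw [Finset.card_union_of_disjoint hd]
      have := Finset.le_card_sdiff N s
      omega
  rcases s.eq_empty_or_nonempty with rfl | ⟨a, ha⟩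
  · exact ⟨∅, by simp⟩
  -- Covers isolated vertices as well as leaves: one vertex is gained and at most two are discarded.
  by_cases hleaf : ∃ a ∈ s, ∃ b, ∀ c ∈ s, adj a c → c = b
  · obtain ⟨a, ha, b, hb⟩ := hleaf
    refine step {a} {a, b} (by simpa) (by simp) (by simpa using irrefl a) (by simp) ?_ ?_
    · rintro x hx c hc h
      obtain rfl := Finset.mem_singleton.1 hx
      simp [hb c hc h]
    · have := Finset.card_le_two (a := a) (b := b)
      simp; omega
  push Not at hleaf
  -- Every vertex now has two neighbours. Along `c, a, b, d, e` the pair `a, d` has all its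
  -- neighbours on the path, so two vertices are gained for at most five, the ratio of the pentagon.
  -- The case `c = e` does no harm.
  obtain ⟨b, hb, hab, -⟩ := hleaf a ha a
  obtain ⟨c, hc, hac, hcb⟩ := hleaf a ha b
  obtain ⟨d, hd, hbd, hda⟩ := hleaf b hb a
  obtain ⟨e, he, hde, heb⟩ := hleaf d hd b
  refine step {a, d} {a, b, c, d, e} (by simp [Finset.insert_subset_iff, ha, hd]) (by simp) ?_
    (by simp [Finset.insert_subset_iff]) ?_ ?_
  · have had : ¬ adj a d := fun h => triangle _ _ _ hab h hbd
    have hda : ¬ adj d a := fun h => had (symm _ _ h)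
    simp [irrefl, had, hda]
  · intro x hx y hy hxy
    simp only [Finset.mem_insert, Finset.mem_singleton] at hx ⊢
    rcases hx with rfl | rfl
    · rcases deg _ ha _ hb _ hc _ hy hab hac hxy with h | h | h
      · exact absurd h.symm hcb
      · simp [h]
      · simp [h]
    · rcases deg _ hd _ hb _ he _ hy (symm _ _ hbd) hde hxy with h | h | h
      · exact absurd h.symm heb
      · simp [h]
      · simp [h]
  · rw [Finset.card_pair (Ne.symm hda)]
    have := Finset.card_le_five (a := a) (b := b) (c := c) (d := d) (e := e)
    omega

/-! ### Incidence of good vertices and cells -/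

namespace Arrangement

variable {ι : Type*} {K : Arrangement ι}

variable (K) in
/-- The height of the horizontal side of a rectangle that contains a given vertex. -/
def height (v : ι × Bool × Bool) : ℝ := if v.2.2 then K.t v.1 else K.b v.1

lemma height_eq {v w : ι × Bool × Bool} (h : K.height v = K.height w) :
    v.1 = w.1 ∧ v.2.2 = w.2.2 := by
  obtain ⟨i, x, _ | _⟩ := v <;> obtain ⟨j, y, _ | _⟩ := w <;> simp [height] at h ⊢
  · exact K.b_inj h
  · exact K.t_ne_b _ _ h.symm
  · exact K.t_ne_b _ _ h
  · exact K.t_inj h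

variable (K) in
/-- `c` is one of the two cells that a good vertex connects. -/
def Inc (c : Box) (v : ι × Bool × Bool) : Prop :=
  K.Flat c v.1 v.2.2 ∧ K.Good c v ∨ K.Corner c v

lemma Inc.height {c : Box} {v : ι × Bool × Bool} (h : K.Inc c v) :
    K.height v = c.t ∨ K.height v = c.b := by
  obtain ⟨i, _ | _, _ | _⟩ := v <;> rcases h with ⟨⟨h, -⟩, -⟩ | ⟨-, h, -⟩ <;>
    simp [Arrangement.height, h]

/-- At a given horizontal side, `Flat` puts the cell beyond the side and `Corner` puts it beside the
rectangle. Both at once would make the top and bottom of `c` coincide. -/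
lemma Flat.false_of_corner {c : Box} (hc : K.IsCell c) {v w : ι × Bool × Bool}
    (h : K.height v = K.height w) (hv : K.Flat c v.1 v.2.2) (hw : K.Corner c w) : False := by
  have := hc.b_lt_t
  obtain ⟨i, x, _ | _⟩ := v <;> obtain ⟨j, _ | _, _ | _⟩ := w <;>
    obtain ⟨rfl, h'⟩ := height_eq h <;> first
    | exact Bool.noConfusion h'
    | linarith [hv.1, hw.2.1]

/-- Two good vertices at the same height that connect the same cell. -/
lemma Inc.flat_of_height_eq {c : Box} (hc : K.IsCell c) {v w : ι × Bool × Bool} (hv : K.Inc c v)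
    (hw : K.Inc c w) (hvw : v ≠ w) (h : K.height v = K.height w) :
    K.Flat c v.1 v.2.2 ∧ K.Good c (v.1, false, v.2.2) ∧ K.Good c (v.1, true, v.2.2) := by
  have hlr := hc.l_lt_r
  rcases hv with ⟨hv, hv'⟩ | hv
  · rcases hw with ⟨hw, hw'⟩ | hw
    · refine ⟨hv, ?_⟩
      obtain ⟨i, x, s⟩ := v
      obtain ⟨j, y, s'⟩ := w
      obtain ⟨rfl, rfl⟩ := height_eq h
      rcases x with _ | _ <;> rcases y with _ | _ <;> simp_all
    · exact (Flat.false_of_corner hc h hv hw).elim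
  · rcases hw with ⟨hw, hw'⟩ | hw
    · exact (Flat.false_of_corner hc h.symm hw hv).elim
    -- Two corners at one height would make the same rectangle both the left and the right wall.
    · obtain ⟨i, x, s⟩ := v
      obtain ⟨j, y, s'⟩ := w
      obtain ⟨rfl, rfl⟩ := height_eq h
      have := K.l_lt_r i
      rcases x with _ | _ <;> rcases y with _ | _ <;> rcases s with _ | _ <;> simp at hvw <;>
        linarith [hv.1, hw.1]

lemma TopL.not_topR {c : Box} (hc : K.IsCell c) {i j : ι} (h : K.TopL c i) (h' : K.TopR c j) :
    False := by
  obtain rfl := K.t_inj (h.2.1.trans h'.2.1.symm)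
  linarith [K.l_lt_r i, hc.l_lt_r, h.1, h'.1]

lemma BotL.not_botR {c : Box} (hc : K.IsCell c) {i j : ι} (h : K.BotL c i) (h' : K.BotR c j) :
    False := by
  obtain rfl := K.b_inj (h.2.1.trans h'.2.1.symm)
  linarith [K.l_lt_r i, hc.l_lt_r, h.1, h'.1]

/-- If both ends of a flat side are good, the opposite side of `c` must carry a flat rectangle that
overhangs at both ends. Then that side has no corner, and neither of the vertices lying on it is
good. -/
lemma Inc.false_of_flat {c : Box} (hc : K.IsCell c) {i : ι} {s : Bool} {w : ι × Bool × Bool}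
    (hf : K.Flat c i s) (hl : K.Good c (i, false, s)) (hr : K.Good c (i, true, s))
    (hw : K.Inc c w) (h : K.height w ≠ K.height (i, true, s)) : False := by
  have hLR := fun i j => TopL.not_topR hc (i := i) (j := j)
  have hLR' := fun i j => BotL.not_botR hc (i := i) (j := j)
  have htb := K.t_ne_b
  have hti := K.t_inj
  have hbi := K.b_inj
  obtain ⟨j, y, s'⟩ := w
  rcases s with _ | _
  · rcases s' with _ | _
    · rcases hw with ⟨hw, -⟩ | hw
      · exact h (hw.1.trans hf.1.symm)
      · simp only [Good] at hl hr
        rcases y with _ | _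
        · rcases hl with ⟨k, hk⟩ | ⟨k, hk, -⟩
          · exact hLR' _ _ hk hw
          · exact htb _ _ (hk.1.trans hw.2.1.symm)
        · rcases hr with ⟨k, hk⟩ | ⟨k, hk, -⟩
          · exact hLR' _ _ hw hk
          · exact htb _ _ (hk.1.trans hw.2.1.symm)
    · rcases hw with ⟨hw, hg⟩ | hw
      · have hb : ∀ k, K.BotF c k → k = j := fun k hk => hti (hk.1.trans hw.1.symm)
        have ht : ∀ k, K.TopF c k → k = i := fun k hk => hbi (hk.1.trans hf.1.symm)
        simp only [Good] at hl hr
        rcases y with _ | _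
        · rcases hl with ⟨k, hk⟩ | ⟨k, hk, hl⟩
          · exact htb _ _ (hw.1.trans hk.2.1.symm)
          · rcases hg with ⟨m, hm⟩ | ⟨m, hm, hg⟩
            · exact htb _ _ (hm.2.1.trans hf.1.symm)
            · rw [hb k hk] at hl
              rw [ht m hm] at hg
              exact lt_asymm hl hg
        · rcases hr with ⟨k, hk⟩ | ⟨k, hk, hr⟩
          · exact htb _ _ (hw.1.trans hk.2.1.symm)
          · rcases hg with ⟨m, hm⟩ | ⟨m, hm, hg⟩
            · exact htb _ _ (hm.2.1.trans hf.1.symm)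
            · rw [hb k hk] at hr
              rw [ht m hm] at hg
              exact lt_asymm hr hg
      · rcases y with _ | _ <;> exact htb _ _ (hw.2.1.trans hf.1.symm)
  · rcases s' with _ | _
    · rcases hw with ⟨hw, hg⟩ | hw
      · have hb : ∀ k, K.BotF c k → k = i := fun k hk => hti (hk.1.trans hf.1.symm)
        have ht : ∀ k, K.TopF c k → k = j := fun k hk => hbi (hk.1.trans hw.1.symm)
        simp only [Good] at hl hr
        rcases y with _ | _
        · rcases hl with ⟨k, hk⟩ | ⟨k, hk, hl⟩
          · exact htb _ _ (hk.2.1.trans hw.1.symm)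
          · rcases hg with ⟨m, hm⟩ | ⟨m, hm, hg⟩
            · exact htb _ _ (hf.1.trans hm.2.1.symm)
            · rw [ht k hk] at hl
              rw [hb m hm] at hg
              exact lt_asymm hl hg
        · rcases hr with ⟨k, hk⟩ | ⟨k, hk, hr⟩
          · exact htb _ _ (hk.2.1.trans hw.1.symm)
          · rcases hg with ⟨m, hm⟩ | ⟨m, hm, hg⟩
            · exact htb _ _ (hf.1.trans hm.2.1.symm)
            · rw [ht k hk] at hr
              rw [hb m hm] at hg
              exact lt_asymm hr hg
      · rcases y with _ | _ <;> exact htb _ _ (hf.1.trans hw.2.1.symm)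
    · rcases hw with ⟨hw, -⟩ | hw
      · exact h (hw.1.trans hf.1.symm)
      · simp only [Good] at hl hr
        rcases y with _ | _
        · rcases hl with ⟨k, hk⟩ | ⟨k, hk, -⟩
          · exact hLR _ _ hk hw
          · exact htb _ _ (hw.2.1.trans hk.1.symm)
        · rcases hr with ⟨k, hk⟩ | ⟨k, hk, -⟩
          · exact hLR _ _ hw hk
          · exact htb _ _ (hw.2.1.trans hk.1.symm)

/-- A cell is connected by at most two good vertices. -/
lemma Inc.eq_or_eq_or_eq {c : Box} (hc : K.IsCell c) {u v w : ι × Bool × Bool} (hu : K.Inc c u)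
    (hv : K.Inc c v) (hw : K.Inc c w) : u = v ∨ u = w ∨ v = w := by
  have key : ∀ {u v w : ι × Bool × Bool}, K.Inc c u → K.Inc c v → K.Inc c w → u ≠ v → u ≠ w →
      v ≠ w → K.height u = K.height v → False := by
    intro u v w hu hv hw huv huw hvw h
    obtain ⟨h₁, h₂, h₃⟩ := hu.flat_of_height_eq hc hv huv h
    by_cases h' : K.height w = K.height u
    · obtain ⟨i, x, s⟩ := u
      obtain ⟨j, y, s'⟩ := v
      obtain ⟨k, z, s''⟩ := w
      obtain ⟨rfl, rfl⟩ := height_eq h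
      obtain ⟨rfl, rfl⟩ := height_eq h'
      rcases x with _ | _ <;> rcases y with _ | _ <;> rcases z with _ | _ <;> simp_all
    · exact Inc.false_of_flat hc h₁ h₂ h₃ hw h'
  by_contra! h
  obtain ⟨h₁, h₂, h₃⟩ := h
  -- Only two heights are available, so two of the three vertices agree.
  rcases hu.height with h | h <;> rcases hv.height with h' | h' <;>
    rcases hw.height with h'' | h'' <;>
    first
    | exact key hu hv hw h₁ h₂ h₃ (h.trans h'.symm)
    | exact key hu hw hv h₂ h₁ h₃.symm (h.trans h''.symm)
    | exact key hv hw hu h₃ h₁.symm h₂.symm (h'.trans h''.symm)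

/-! ### Counting good vertices and cells -/

/-- The number of flat sides of a cell, compared with the number of its good vertices. -/
lemma IsCell.card_flat_le [Fintype ι] {c : Box} (hc : K.IsCell c) (S : Finset (ι × Bool))
    (hS : ∀ p, p ∈ S → K.Flat c p.1 p.2) (T : Finset (ι × Bool × Bool))
    (hT : ∀ v, K.Flat c v.1 v.2.2 → K.Good c v → v ∈ T) :
    S.card ≤ T.card + ((if c.t = K.M then 1 else 0) + if c.b = -K.M then 1 else 0) := by
  classical
  have hbt := hc.b_lt_t
  have hbot : ∀ i j, K.BotF c i → K.BotF c j → i = j := fun i j h h' =>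
    K.t_inj (h.1.trans h'.1.symm)
  have htop : ∀ i j, K.TopF c i → K.TopF c j → i = j := fun i j h h' =>
    K.b_inj (h.1.trans h'.1.symm)
  by_cases hb : ∃ i, K.BotF c i <;> by_cases ht : ∃ j, K.TopF c j
  · obtain ⟨i, hi⟩ := hb
    obtain ⟨j, hj⟩ := ht
    have hij : i ≠ j := by
      rintro rfl
      linarith [hi.1, hj.1, K.b_lt_t i]
    have hS' : S ⊆ {(i, true), (j, false)} := by
      rintro ⟨k, _ | _⟩ hk
      · simp [htop k j (hS _ hk) hj]
      · simp [hbot k i (hS _ hk) hi]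
    -- Of the two rectangles, the one reaching further left makes the left vertex of the other good;
    -- likewise on the right.
    have hl : ∃ v ∈ T, v.2.1 = false := by
      rcases lt_or_gt_of_ne (K.l_inj.ne hij) with h | h
      · exact ⟨(j, false, false), hT _ hj (Or.inr ⟨i, hi, h⟩), rfl⟩
      · exact ⟨(i, false, true), hT _ hi (Or.inr ⟨j, hj, h⟩), rfl⟩
    have hr : ∃ v ∈ T, v.2.1 = true := by
      rcases lt_or_gt_of_ne (K.r_inj.ne hij) with h | h
      · exact ⟨(i, true, true), hT _ hi (Or.inr ⟨j, hj, h⟩), rfl⟩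
      · exact ⟨(j, true, false), hT _ hj (Or.inr ⟨i, hi, h⟩), rfl⟩
    obtain ⟨v, hv, hv'⟩ := hl
    obtain ⟨w, hw, hw'⟩ := hr
    have hvw : v ≠ w := by rintro rfl; simp [hv'] at hw'
    have h₁ := Finset.card_le_card hS'
    have h₂ := Finset.card_le_two (a := (i, true)) (b := (j, false))
    have h₃ : ({v, w} : Finset _).card ≤ T.card :=
      Finset.card_le_card (by simp [Finset.insert_subset_iff, hv, hw])
    rw [Finset.card_pair hvw] at h₃
    omega
  · obtain ⟨i, hi⟩ := hb
    have hS' : S.card ≤ 1 := (Finset.card_le_card (t := {(i, true)}) (by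
      rintro ⟨k, _ | _⟩ hk
      · exact (ht ⟨k, hS _ hk⟩).elim
      · simp [hbot k i (hS _ hk) hi])).trans_eq
        (Finset.card_singleton _)
    -- A wall level with the top makes one vertex good; only at the border of the square is there
    -- none, whence the correction term.
    rcases hc.top with h | ⟨j, h⟩ | ⟨j, h⟩ | h
    · rw [if_pos h]; omega
    · have := Finset.card_pos.2 ⟨_, hT (i, false, true) hi (Or.inl ⟨j, h⟩)⟩
      omega
    · have := Finset.card_pos.2 ⟨_, hT (i, true, true) hi (Or.inl ⟨j, h⟩)⟩
      omega
    · exact (ht h).elim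
  · obtain ⟨i, hi⟩ := ht
    have hS' : S.card ≤ 1 := (Finset.card_le_card (t := {(i, false)}) (by
      rintro ⟨k, _ | _⟩ hk
      · simp [htop k i (hS _ hk) hi]
      · exact (hb ⟨k, hS _ hk⟩).elim)).trans_eq
        (Finset.card_singleton _)
    rcases hc.bot with h | ⟨j, h⟩ | ⟨j, h⟩ | h
    · rw [if_pos h]; omega
    · have := Finset.card_pos.2 ⟨_, hT (i, false, false) hi (Or.inl ⟨j, h⟩)⟩
      omega
    · have := Finset.card_pos.2 ⟨_, hT (i, true, false) hi (Or.inl ⟨j, h⟩)⟩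
      omega
    · exact (hb h).elim
  · have : S = ∅ := Finset.eq_empty_of_forall_notMem fun ⟨k, s⟩ hk => by
      rcases s with _ | _
      · exact ht ⟨k, hS _ hk⟩
      · exact hb ⟨k, hS _ hk⟩
    simp [this]

variable (K) in
/-- The position of a cell relative to the rectangle that bounds it from above. -/
def Labelled (c : Box) : Option (ι × Fin 3) → Prop
  | none => c.t = K.M
  | some (i, 0) => K.TopL c i
  | some (i, 1) => K.TopR c i
  | some (i, 2) => K.TopF c i

lemma IsCell.exists_labelled {c : Box} (hc : K.IsCell c) : ∃ x, K.Labelled c x := by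
  rcases hc.top with h | ⟨i, h⟩ | ⟨i, h⟩ | ⟨i, h⟩
  exacts [⟨none, h⟩, ⟨some (i, 0), h⟩, ⟨some (i, 1), h⟩, ⟨some (i, 2), h⟩]

lemma IsCell.l_eq {c : Box} (hc : K.IsCell c) (h : c.t = K.M) : c.l = -K.M :=
  hc.left.resolve_right fun ⟨i, _, _, h'⟩ => by linarith [K.t_lt i]

lemma IsCell.r_eq {c : Box} (hc : K.IsCell c) (h : c.t = K.M) : c.r = K.M :=
  hc.right.resolve_right fun ⟨i, _, _, h'⟩ => by linarith [K.t_lt i]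

lemma Labelled.eq {c d : Box} (hc : K.IsCell c) (hd : K.IsCell d) {x : Option (ι × Fin 3)}
    (hcx : K.Labelled c x) (hdx : K.Labelled d x) : c = d := by
  have h₁ := hc.l_lt_r
  have h₂ := hd.l_lt_r
  have h₃ := hc.b_lt_t
  have h₄ := hd.b_lt_t
  rcases x with _ | ⟨i, x⟩
  · have h₅ := hc.l_eq hcx
    have h₆ := hd.l_eq hdx
    have h₇ := hc.r_eq hcx
    have h₈ := hd.r_eq hdx
    simp only [Labelled] at hcx hdx
    exact hc.eq_of_overlap hd (by linarith) (by linarith) (by linarith) (by linarith)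
  · have := K.l_lt_r i
    fin_cases x <;> obtain ⟨h₅, h₆, h₇⟩ := hcx <;> obtain ⟨h₅', h₆', h₇'⟩ := hdx <;>
      exact hc.eq_of_overlap hd (by linarith) (by linarith) (by linarith) (by linarith)

/-- There are at most `3k + 1` cells. -/
lemma exists_finset_isCell [Fintype ι] : ∃ C : Finset Box, (∀ c, c ∈ C ↔ K.IsCell c) ∧
    C.card ≤ 3 * Fintype.card ι + 1 := by
  classical
  -- Finiteness and the bound both come from injecting cells into the `3k + 1` labels: cells with
  -- the same label overlap.
  choose f hf using fun c : {c // K.IsCell c} => c.2.exists_labelled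
  have hinj : Function.Injective f := fun c d h =>
    Subtype.ext (Labelled.eq c.2 d.2 (hf c) (h ▸ hf d))
  have := Finite.of_injective f hinj
  have := Fintype.ofFinite {c // K.IsCell c}
  refine ⟨Finset.univ.map (Function.Embedding.subtype _), fun c => ⟨fun h => ?_, fun h =>
    Finset.mem_map.2 ⟨⟨c, h⟩, Finset.mem_univ _, rfl⟩⟩, ?_⟩
  · obtain ⟨a, -, rfl⟩ := Finset.mem_map.1 h
    exact a.2
  rw [Finset.card_map, Finset.card_univ]
  refine (Fintype.card_le_of_injective f hinj).trans ?_
  simp [mul_comm]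

lemma Flat.eq {c d : Box} (hc : K.IsCell c) (hd : K.IsCell d) {i : ι} {s : Bool}
    (h : K.Flat c i s) (h' : K.Flat d i s) : c = d := by
  have h₁ := hc.l_lt_r
  have h₂ := hd.l_lt_r
  have h₃ := hc.b_lt_t
  have h₄ := hd.b_lt_t
  have := K.l_lt_r i
  rcases s with _ | _ <;> obtain ⟨h₅, h₆, h₇⟩ := h <;> obtain ⟨h₅', h₆', h₇'⟩ := h' <;>
    exact hc.eq_of_overlap hd (by linarith) (by linarith) (by linarith) (by linarith)

/-- All but at most two flat sides are matched by good vertices. -/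
lemma two_mul_card_le [Fintype ι] {F : ι → Bool → Box} (hF : ∀ i s, K.IsCell (F i s))
    (hF' : ∀ i s, K.Flat (F i s) i s) (E : Finset (ι × Bool × Bool))
    (hE : ∀ v, v ∈ E ↔ K.Good (F v.1 v.2.2) v) : 2 * Fintype.card ι ≤ E.card + 2 := by
  classical
  obtain ⟨C, hC, -⟩ := K.exists_finset_isCell
  have h₁ : (Finset.univ : Finset (ι × Bool)).card =
      ∑ c ∈ C, (Finset.univ.filter fun p : ι × Bool => F p.1 p.2 = c).card :=
    Finset.card_eq_sum_card_fiberwise fun p _ => (hC _).2 (hF _ _)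
  have h₂ : E.card = ∑ c ∈ C, (E.filter fun v => F v.1 v.2.2 = c).card :=
    Finset.card_eq_sum_card_fiberwise fun p _ => (hC _).2 (hF _ _)
  have h₃ := Finset.sum_le_sum fun c (hc : c ∈ C) => ((hC c).1 hc).card_flat_le
    (Finset.univ.filter fun p : ι × Bool => F p.1 p.2 = c)
    (fun p hp => (Finset.mem_filter.1 hp).2 ▸ hF' p.1 p.2)
    (E.filter fun v => F v.1 v.2.2 = c)
    (fun v hv hg => by
      have h := Flat.eq (hF _ _) ((hC c).1 hc) (hF' _ _) hv
      exact Finset.mem_filter.2 ⟨(hE v).2 (h ▸ hg), h⟩)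
  rw [Finset.sum_add_distrib, Finset.sum_add_distrib, ← h₁, ← h₂, ← Finset.card_filter,
    ← Finset.card_filter, Finset.card_univ, Fintype.card_prod, Fintype.card_bool] at h₃
  have h₄ : (C.filter fun c => c.t = K.M).card ≤ 1 := Finset.card_le_one.2 fun c hc d hd => by
    simp only [Finset.mem_filter, hC] at hc hd
    exact Labelled.eq (x := none) hc.1 hd.1 hc.2 hd.2
  have h₅ : (C.filter fun c => c.b = -K.M).card ≤ 1 := Finset.card_le_one.2 fun c hc d hd => by
    simp only [Finset.mem_filter, hC] at hc hd
    have : c.flipY = d.flipY := Labelled.eq (x := none) hc.1.flipY hd.1.flipY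
      (neg_eq_iff_eq_neg.2 hc.2) (neg_eq_iff_eq_neg.2 hd.2)
    simpa using congrArg Box.flipY this
  omega

end Arrangement
end FreeSpaceGuarding

/-! ### The bound in general position -/

namespace FreeSpaceGuarding

namespace Arrangement

variable {ι : Type*} {K : Arrangement ι}

/-- The two cells next to a vertex lie on different sides of a horizontal line. -/
lemma Flat.t_eq_or_t_eq {c d : Box} {v : ι × Bool × Bool} (hc : K.Flat c v.1 v.2.2)
    (hd : K.Corner d v) : c.t = d.b ∨ c.b = d.t := by
  obtain ⟨i, _ | _, _ | _⟩ := v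
  exacts [Or.inl (hc.1.symm.trans hd.2.1), Or.inr (hc.1.symm.trans hd.2.1),
    Or.inl (hc.1.symm.trans hd.2.1), Or.inr (hc.1.symm.trans hd.2.1)]

/-- The cells of an arrangement of `k` rectangles are seen by at most `(11k + 9) / 5` guards. -/
theorem exists_guards [Fintype ι] [Nonempty ι] (K : Arrangement ι) :
    ∃ G : Finset ((ι × Bool × Bool) × Direction), 5 * G.card ≤ 11 * Fintype.card ι + 9 ∧
      ∀ c, K.IsCell c → ∃ g ∈ G, ∀ p ∈ c.carrier, (vertexGuard K.rect g).Sees K.rect p := by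
  classical
  choose F hF hF' using K.exists_flat
  choose D hD hD' hFD using fun v : ι × Bool × Bool => exists_corner (hF v.1 v.2.2) v (hF' v.1 v.2.2)
  obtain ⟨C, hC, hCcard⟩ := K.exists_finset_isCell
  let E : Finset (ι × Bool × Bool) := Finset.univ.filter fun v => K.Good (F v.1 v.2.2) v
  have hE : ∀ v, v ∈ E ↔ K.Good (F v.1 v.2.2) v := by simp [E]
  have hEcard := two_mul_card_le hF hF' E hE
  let cells : ι × Bool × Bool → Finset Box := fun v => {F v.1 v.2.2, D v}
  have hcells : ∀ v, ∀ c ∈ cells v, K.IsCell c := by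
    intro v c hc
    rcases Finset.mem_insert.1 hc with rfl | hc
    · exact hF _ _
    · exact Finset.mem_singleton.1 hc ▸ hD v
  have hne : ∀ v, F v.1 v.2.2 ≠ D v := fun v h =>
    Flat.false_of_corner (hD v) rfl (h ▸ hF' v.1 v.2.2) (hD' v)
  have hinc : ∀ v ∈ E, ∀ c ∈ cells v, K.Inc c v := by
    intro v hv c hc
    rcases Finset.mem_insert.1 hc with rfl | hc
    · exact Or.inl ⟨hF' _ _, (hE v).1 hv⟩
    · exact Finset.mem_singleton.1 hc ▸ Or.inr (hD' v)
  have hlevel : ∀ v, ∀ c ∈ cells v, ∀ d ∈ cells v, c ≠ d → c.t = d.b ∨ c.b = d.t := by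
    intro v c hc d hd hcd
    have := (hF' v.1 v.2.2).t_eq_or_t_eq (hD' v)
    simp only [cells, Finset.mem_insert, Finset.mem_singleton] at hc hd
    rcases hc with rfl | rfl <;> rcases hd with rfl | rfl
    · exact absurd rfl hcd
    · exact this
    · exact this.symm.imp Eq.symm Eq.symm
    · exact absurd rfl hcd
  have htriple : ∀ c, ∀ u ∈ E, ∀ v ∈ E, ∀ w ∈ E, c ∈ cells u → c ∈ cells v → c ∈ cells w →
      u = v ∨ u = w ∨ v = w := fun c u hu v hv w hw hcu hcv hcw =>
    Inc.eq_or_eq_or_eq (hcells u c hcu) (hinc u hu c hcu) (hinc v hv c hcv) (hinc w hw c hcw)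
  obtain ⟨I, hIE, hI, hIcard⟩ := exists_independent
    (fun v w => v ∈ E ∧ w ∈ E ∧ v ≠ w ∧ ∃ c ∈ cells v, c ∈ cells w)
    (fun v w ⟨hv, hw, h, c, hc, hc'⟩ => ⟨hw, hv, h.symm, c, hc', hc⟩)
    (fun v h => h.2.2.1 rfl)
    (by
      -- The three shared cells are distinct, since none serves three vertices. Any two of them
      -- touch across a horizontal line, but the middle one has positive height.
      rintro u v w ⟨hu, hv, huv, x, hxu, hxv⟩ ⟨-, hw, huw, y, hyu, hyw⟩ ⟨-, -, hvw, z, hzv, hzw⟩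
      have hxy : x ≠ y := by
        rintro rfl; have := htriple x u hu v hv w hw hxu hxv hyw; tauto
      have hxz : x ≠ z := by
        rintro rfl; have := htriple x u hu v hv w hw hxu hxv hzw; tauto
      have hyz : y ≠ z := by
        rintro rfl; have := htriple y u hu v hv w hw hyu hzv hyw; tauto
      have hx := (hcells u x hxu).b_lt_t
      have hy := (hcells u y hyu).b_lt_t
      have hz := (hcells v z hzv).b_lt_t
      rcases hlevel u x hxu y hyu hxy with h | h <;>
        rcases hlevel v x hxv z hzv hxz with h' | h' <;>
        rcases hlevel w y hyw z hzw hyz with h'' | h'' <;> linarith)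
    E
    (by
      -- Among three neighbours, two would share the same one of the two cells of `u`, which would
      -- then serve three vertices.
      rintro u - v - w - x - ⟨hu, hv, huv, a, hau, hav⟩ ⟨-, hw, huw, b, hbu, hbw⟩
        ⟨-, hx, hux, c, hcu, hcx⟩
      have h₁ : a = b ∨ a = c ∨ b = c := by
        simp only [cells, Finset.mem_insert, Finset.mem_singleton] at hau hbu hcu
        rcases hau with rfl | rfl <;> rcases hbu with rfl | rfl <;>
          rcases hcu with rfl | rfl <;> simp
      rcases h₁ with rfl | rfl | rfl
      · have := htriple a u hu v hv w hw hau hav hbw; tauto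
      · have := htriple a u hu v hv x hx hau hav hcx; tauto
      · have := htriple b u hu w hw x hx hbu hbw hcx; tauto)
  have hU : (I.biUnion cells).card = 2 * I.card := by
    rw [Finset.card_biUnion, Finset.sum_const_nat fun v _ => Finset.card_pair (hne v), mul_comm]
    intro v hv w hw hvw
    exact Finset.disjoint_left.2 fun c hc hc' => hI v hv w hw ⟨hIE hv, hIE hw, hvw, c, hc, hc'⟩
  have hUC : I.biUnion cells ⊆ C := Finset.biUnion_subset.2 fun v _ c hc => (hC c).2 (hcells v c hc)
  have g₀ : ∀ c, ∃ g, K.IsCell c → ∀ p ∈ c.carrier, (vertexGuard K.rect g).Sees K.rect p := by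
    intro c
    by_cases hc : K.IsCell c
    · obtain ⟨g, hg⟩ := hc.exists_guard
      exact ⟨g, fun _ => hg⟩
    · exact ⟨((Classical.arbitrary ι, true, true), .east), fun h => (hc h).elim⟩
  have g₁ : ∀ v, ∃ g, v ∈ E → ∀ c ∈ cells v, ∀ p ∈ c.carrier,
      (vertexGuard K.rect g).Sees K.rect p := by
    intro v
    by_cases hv : v ∈ E
    · obtain ⟨g, hg⟩ := Good.exists_guard (hF _ _) (hD v) v ((hE v).1 hv) (hF' _ _) (hD' v) (hFD v)
      refine ⟨g, fun _ c hc p hp => hg p ?_⟩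
      rcases Finset.mem_insert.1 hc with rfl | hc
      · exact Or.inl hp
      · exact Or.inr (Finset.mem_singleton.1 hc ▸ hp)
    · exact ⟨((Classical.arbitrary ι, true, true), .east), fun h => (hv h).elim⟩
  choose g₀ hg₀ using g₀
  choose g₁ hg₁ using g₁
  refine ⟨I.image g₁ ∪ (C \ I.biUnion cells).image g₀, ?_, fun c hc => ?_⟩
  -- The total is at most `|I| + (|C| - 2|I|)`, with `|C| ≤ 3k + 1` and `5|I| ≥ 2(2k - 2)`.
  · have h₁ := Finset.card_union_le (I.image g₁) ((C \ I.biUnion cells).image g₀)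
    have h₂ := Finset.card_image_le (s := I) (f := g₁)
    have h₃ := Finset.card_image_le (s := C \ I.biUnion cells) (f := g₀)
    rw [Finset.card_sdiff_of_subset hUC] at h₃
    have h₄ := Finset.card_le_card hUC
    omega
  · by_cases h : c ∈ I.biUnion cells
    · obtain ⟨v, hv, hcv⟩ := Finset.mem_biUnion.1 h
      exact ⟨g₁ v, Finset.mem_union_left _ (Finset.mem_image_of_mem _ hv), hg₁ v (hIE hv) c hcv⟩
    · exact ⟨g₀ c, Finset.mem_union_right _ (Finset.mem_image_of_mem _
        (Finset.mem_sdiff.2 ⟨(hC c).2 hc, h⟩)), hg₀ c hc⟩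

end Arrangement
end FreeSpaceGuarding

/-! ### Reduction to general position by shrinking -/

namespace FreeSpaceGuarding

open Filter Topology

variable {k : ℕ}

/-- `K` arises from the rectangles `R` by shrinking them by different amounts, all of order `δ`. -/
structure IsShrinking (R : Fin k → IsoRect) (δ : ℝ) (K : Arrangement (Fin k)) : Prop where
  -- The factors `i + 1` are positive, so every side moves inward, and distinct, so ties are broken.
  -- The choice `K.M = δ⁻¹` lets the square exhaust the plane.
  l_eq : ∀ i, K.l i = (R i).left + δ * (i + 1)
  r_eq : ∀ i, K.r i = (R i).right - δ * (i + 1)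
  b_eq : ∀ i, K.b i = (R i).bottom + δ * (i + 1)
  t_eq : ∀ i, K.t i = (R i).top - δ * (i + 1)
  M_eq : K.M = δ⁻¹

/-- Affine functions with different slopes agree at one `δ` only. -/
lemma eventually_add_mul_ne (u v : ℝ) {a b : ℝ} (h : a ≠ b) :
    ∀ᶠ δ in 𝓝[>] (0 : ℝ), u + δ * a ≠ v + δ * b := by
  have hab : a - b ≠ 0 := sub_ne_zero.2 h
  have : ∀ᶠ δ in 𝓝[>] (0 : ℝ), δ ≠ (v - u) / (a - b) := by
    rcases eq_or_ne 0 ((v - u) / (a - b)) with h0 | h0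
    · rw [← h0]
      filter_upwards [self_mem_nhdsWithin] with δ hδ using ne_of_gt hδ
    · exact nhdsWithin_le_nhds (isOpen_ne.mem_nhds h0)
  filter_upwards [this] with δ hδ h'
  exact hδ ((eq_div_iff hab).2 (by linarith))

lemma eventually_lt_of_lt {f g : ℝ → ℝ} (hf : Continuous f) (hg : Continuous g) (h : f 0 < g 0) :
    ∀ᶠ δ in 𝓝[>] (0 : ℝ), f δ < g δ :=
  nhdsWithin_le_nhds ((isOpen_lt hf hg).mem_nhds h)

lemma eventually_abs_lt_inv (a : ℝ) : ∀ᶠ δ in 𝓝[>] (0 : ℝ), |a| < δ⁻¹ :=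
  tendsto_inv_nhdsGT_zero.eventually_gt_atTop |a|

lemma separated_of_disjoint {R S : IsoRect} (h : Disjoint R.carrier S.carrier) :
    R.right < S.left ∨ S.right < R.left ∨ R.top < S.bottom ∨ S.top < R.bottom := by
  by_contra! h'
  obtain ⟨h₁, h₂, h₃, h₄⟩ := h'
  refine Set.disjoint_left.1 h
    (?_ : (max R.left S.left, max R.bottom S.bottom) ∈ R.carrier) ?_ <;>
    constructor <;> constructor <;>
    simp [h₁, h₂, h₃, h₄, R.left_lt_right.le, S.left_lt_right.le, R.bottom_lt_top.le,
      S.bottom_lt_top.le]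

/-- Rectangles that are shrunk a little by suitable amounts are in general position. -/
lemma eventually_exists_isShrinking (R : Fin k → IsoRect)
    (hR : Pairwise fun i j => Disjoint (R i).carrier (R j).carrier) :
    ∀ᶠ δ in 𝓝[>] (0 : ℝ), ∃ K, IsShrinking R δ K := by
  have hw : ∀ i : Fin k, (0 : ℝ) < (i : ℝ) + 1 := fun i => by positivity
  have hne : ∀ i j : Fin k, i ≠ j → (i : ℝ) + 1 ≠ (j : ℝ) + 1 := fun i j h h' =>
    h (Fin.ext (by exact_mod_cast add_right_cancel h'))
  have hne' : ∀ i j : Fin k, i ≠ j → -((i : ℝ) + 1) ≠ -((j : ℝ) + 1) := fun i j h h' =>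
    hne i j h (neg_injective h')
  have h₁ : ∀ᶠ δ in 𝓝[>] (0 : ℝ), ∀ i, (R i).left + δ * (i + 1) < (R i).right - δ * (i + 1) :=
    eventually_all.2 fun i => eventually_lt_of_lt (by fun_prop) (by fun_prop)
      (by simpa using (R i).left_lt_right)
  have h₂ : ∀ᶠ δ in 𝓝[>] (0 : ℝ), ∀ i, (R i).bottom + δ * (i + 1) < (R i).top - δ * (i + 1) :=
    eventually_all.2 fun i => eventually_lt_of_lt (by fun_prop) (by fun_prop)
      (by simpa using (R i).bottom_lt_top)
  have h₃ : ∀ u : Fin k → ℝ, ∀ᶠ δ in 𝓝[>] (0 : ℝ), ∀ i j, i ≠ j →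
      u i + δ * (i + 1) ≠ u j + δ * (j + 1) := fun u =>
    eventually_all.2 fun i => eventually_all.2 fun j => by
      by_cases h : i = j
      · simp [h]
      · simpa [h] using eventually_add_mul_ne (u i) (u j) (hne i j h)
  have h₄ : ∀ u : Fin k → ℝ, ∀ᶠ δ in 𝓝[>] (0 : ℝ), ∀ i j, i ≠ j →
      u i + δ * -(i + 1) ≠ u j + δ * -(j + 1) := fun u =>
    eventually_all.2 fun i => eventually_all.2 fun j => by
      by_cases h : i = j
      · simp [h]
      · simpa only [h, ne_eq, not_false_eq_true, true_imp_iff] using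
          eventually_add_mul_ne (u i) (u j) (hne' i j h)
  have h₅ : ∀ᶠ δ in 𝓝[>] (0 : ℝ), ∀ i j,
      (R i).top + δ * -(i + 1) ≠ (R j).bottom + δ * (j + 1) :=
    eventually_all.2 fun i => eventually_all.2 fun j =>
      eventually_add_mul_ne _ _ (by linarith [hw i, hw j] : -((i : ℝ) + 1) < (j : ℝ) + 1).ne
  have h₆ : ∀ u : Fin k → ℝ, ∀ᶠ δ in 𝓝[>] (0 : ℝ), ∀ i, |u i| < δ⁻¹ := fun u =>
    eventually_all.2 fun i => eventually_abs_lt_inv _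
  filter_upwards [self_mem_nhdsWithin, h₁, h₂, h₃ fun i => (R i).left, h₃ fun i => (R i).bottom,
    h₄ fun i => (R i).right, h₄ fun i => (R i).top, h₅, h₆ fun i => (R i).left,
    h₆ fun i => (R i).right, h₆ fun i => (R i).bottom, h₆ fun i => (R i).top]
    with δ hδ hlr hbt hl hb hr ht htb hl' hr' hb' ht'
  have hδw : ∀ i : Fin k, 0 < δ * ((i : ℝ) + 1) := fun i => mul_pos hδ (hw i)
  refine ⟨⟨fun i => (R i).left + δ * (i + 1), fun i => (R i).right - δ * (i + 1),
    fun i => (R i).bottom + δ * (i + 1), fun i => (R i).top - δ * (i + 1), δ⁻¹, hlr, hbt, ?_,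
    ?_, ?_, ?_, ?_, ?_, ?_, ?_, ?_, ?_⟩, fun _ => rfl, fun _ => rfl, fun _ => rfl, fun _ => rfl, rfl⟩
  · intro i j hij
    have := hδw i
    have := hδw j
    rcases separated_of_disjoint (hR hij) with h | h | h | h
    · exact Or.inl (by linarith)
    · exact Or.inr (Or.inl (by linarith))
    · exact Or.inr (Or.inr (Or.inl (by linarith)))
    · exact Or.inr (Or.inr (Or.inr (by linarith)))
  · exact fun i j h => by_contra fun hij => hl i j hij h
  · exact fun i j h => by_contra fun hij => hr i j hij (by simp only at h; linarith)
  · exact fun i j h => by_contra fun hij => hb i j hij h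
  · exact fun i j h => by_contra fun hij => ht i j hij (by simp only at h; linarith)
  · exact fun i j h => htb i j (by linarith)
  · exact fun i => by linarith [hδw i, (abs_lt.1 (hl' i)).1]
  · exact fun i => by linarith [hδw i, (abs_lt.1 (hr' i)).2]
  · exact fun i => by linarith [hδw i, (abs_lt.1 (hb' i)).1]
  · exact fun i => by linarith [hδw i, (abs_lt.1 (ht' i)).2]

/-- The position of a vertex of the shrunk rectangle `i`, as a function of the amount. -/
def shrunkVertex (R : Fin k → IsoRect) (v : Fin k × Bool × Bool) (δ : ℝ) : ℝ × ℝ :=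
  (if v.2.1 then (R v.1).right - δ * (v.1 + 1) else (R v.1).left + δ * (v.1 + 1),
    if v.2.2 then (R v.1).top - δ * (v.1 + 1) else (R v.1).bottom + δ * (v.1 + 1))

lemma continuous_shrunkVertex (R : Fin k → IsoRect) (v : Fin k × Bool × Bool) :
    Continuous (shrunkVertex R v) := by
  unfold shrunkVertex
  obtain ⟨i, _ | _, _ | _⟩ := v <;> simp only [Bool.false_eq_true, if_true, if_false] <;> fun_prop

lemma shrunkVertex_zero (R : Fin k → IsoRect) (g : (Fin k × Bool × Bool) × Direction) :
    (vertexGuard R g).pos = shrunkVertex R g.1 0 := by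
  simp [vertexGuard, shrunkVertex, IsoRect.vertex]

lemma IsShrinking.pos_eq {R : Fin k → IsoRect} {δ : ℝ} {K : Arrangement (Fin k)}
    (h : IsShrinking R δ K) (g : (Fin k × Bool × Bool) × Direction) :
    (vertexGuard K.rect g).pos = shrunkVertex R g.1 δ := by
  simp [vertexGuard, shrunkVertex, IsoRect.vertex, Arrangement.rect, h.l_eq, h.r_eq, h.b_eq, h.t_eq]

/-- A point that a guard does not see remains unseen when the rectangles shrink a little and the
point moves a little. -/
lemma eventually_not_sees (R : Fin k → IsoRect) (g : (Fin k × Bool × Bool) × Direction) {p : ℝ × ℝ}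
    (h : ¬ (vertexGuard R g).Sees R p) :
    ∀ᶠ x in 𝓝 ((0 : ℝ), p), ∀ K, IsShrinking R x.1 K →
      ¬ (vertexGuard K.rect g).Sees K.rect x.2 := by
  have hv := (continuous_shrunkVertex R g.1).comp (continuous_fst (X := ℝ) (Y := ℝ × ℝ))
  have hx : ∀ a b : ℝ, Continuous fun x : ℝ × ℝ × ℝ => a * (shrunkVertex R g.1 x.1).1 + b * x.2.1 :=
    fun a b => (continuous_const.mul hv.fst).add (by fun_prop)
  have hy : ∀ a b : ℝ, Continuous fun x : ℝ × ℝ × ℝ => a * (shrunkVertex R g.1 x.1).2 + b * x.2.2 :=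
    fun a b => (continuous_const.mul hv.snd).add (by fun_prop)
  have hlt : ∀ {f f' : ℝ × ℝ × ℝ → ℝ}, Continuous f → Continuous f' → f (0, p) < f' (0, p) →
      ∀ᶠ x in 𝓝 ((0 : ℝ), p), f x < f' x := fun hf hf' h => (isOpen_lt hf hf').mem_nhds h
  by_cases hp : p ∈ (vertexGuard R g).fieldOfVision
  · have h' : ¬ segment ℝ (vertexGuard R g).pos p ⊆ freeSpace R := fun hs => h ⟨hp, hs⟩
    -- With the weights `a, b` fixed, the blocking point depends continuously on the shrinking and
    -- on `p`, and it lies in an open rectangle.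
    obtain ⟨q, ⟨a, b, ha, hb, hab, rfl⟩, hq⟩ := Set.not_subset.1 h'
    simp only [freeSpace, Set.mem_ofPred_eq, not_forall, not_not] at hq
    obtain ⟨i, hi⟩ := hq
    rw [IsoRect.interior_carrier, shrunkVertex_zero] at hi
    obtain ⟨⟨h₁, h₂⟩, h₃, h₄⟩ := hi
    simp only [Prod.fst_add, Prod.smul_fst, smul_eq_mul, Prod.snd_add, Prod.smul_snd] at h₁ h₂ h₃ h₄
    filter_upwards [
      hlt (f := fun x => (R i).left + x.1 * (i + 1))
        (f' := fun x => a * (shrunkVertex R g.1 x.1).1 + b * x.2.1) (by fun_prop) (hx a b)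
        (by simpa using h₁),
      hlt (f' := fun x => (R i).right - x.1 * (i + 1))
        (f := fun x => a * (shrunkVertex R g.1 x.1).1 + b * x.2.1) (hx a b) (by fun_prop)
        (by simpa using h₂),
      hlt (f := fun x => (R i).bottom + x.1 * (i + 1))
        (f' := fun x => a * (shrunkVertex R g.1 x.1).2 + b * x.2.2) (by fun_prop) (hy a b)
        (by simpa using h₃),
      hlt (f' := fun x => (R i).top - x.1 * (i + 1))
        (f := fun x => a * (shrunkVertex R g.1 x.1).2 + b * x.2.2) (hy a b) (by fun_prop)
        (by simpa using h₄)] with x h₁ h₂ h₃ h₄ K hK hs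
    refine hs.2 ⟨a, b, ha, hb, hab, rfl⟩ i ?_
    rw [IsoRect.interior_carrier, hK.pos_eq]
    simp only [Arrangement.rect, hK.l_eq, hK.r_eq, hK.b_eq, hK.t_eq]
    exact ⟨⟨h₁, h₂⟩, h₃, h₄⟩
  · simp only [Guard.fieldOfVision, Set.mem_ofPred_eq, not_le, shrunkVertex_zero] at hp
    filter_upwards [hlt (f := fun x => (x.2.1 - (shrunkVertex R g.1 x.1).1) * g.2.vec.1 +
        (x.2.2 - (shrunkVertex R g.1 x.1).2) * g.2.vec.2) (f' := fun _ => 0)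
        ((((by fun_prop : Continuous fun x : ℝ × ℝ × ℝ => x.2.1).sub hv.fst).mul continuous_const).add
          (((by fun_prop : Continuous fun x : ℝ × ℝ × ℝ => x.2.2).sub hv.snd).mul continuous_const))
        continuous_const hp] with x hx K hK hs
    have := hs.1
    simp only [Guard.fieldOfVision, Set.mem_ofPred_eq, hK.pos_eq] at this
    exact hx.not_ge this

/-- A point of the free space has points in general position nearby. -/
lemma eventually_general (R : Fin k → IsoRect) {p : ℝ × ℝ} (hp : p ∈ freeSpace R) {δ : ℝ}
    (hδ : 0 < δ) {K : Arrangement (Fin k)} (hK : IsShrinking R δ K) :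
    ∀ᶠ η in 𝓝[>] (0 : ℝ), ∀ i, K.b i ≠ p.2 + η ∧ K.t i ≠ p.2 + η ∧
      (K.b i < p.2 + η → p.2 + η < K.t i → K.r i < p.1 ∨ p.1 < K.l i) := by
  refine eventually_all.2 fun i => ?_
  have hw : 0 < δ * ((i : ℝ) + 1) := by positivity
  have hl := hK.l_eq i
  have hr := hK.r_eq i
  have hb := hK.b_eq i
  have ht := hK.t_eq i
  have h₁ := eventually_add_mul_ne p.2 (K.b i) (one_ne_zero (α := ℝ))
  have h₂ := eventually_add_mul_ne p.2 (K.t i) (one_ne_zero (α := ℝ))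
  have h₃ : ∀ᶠ η in 𝓝[>] (0 : ℝ),
      (K.b i < p.2 + η → p.2 + η < K.t i → K.r i < p.1 ∨ p.1 < K.l i) := by
    have hi := hp i
    rw [IsoRect.interior_carrier] at hi
    have : p.1 ≤ (R i).left ∨ (R i).right ≤ p.1 ∨ p.2 ≤ (R i).bottom ∨ (R i).top ≤ p.2 := by
      by_contra! h
      exact hi ⟨⟨h.1, h.2.1⟩, h.2.2⟩
    -- Shrinking has already made the horizontal separations strict, so moving `p` vertically is
    -- enough.
    rcases this with h | h | h | h
    · exact Eventually.of_forall fun η _ _ => Or.inr (by linarith)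
    · exact Eventually.of_forall fun η _ _ => Or.inl (by linarith)
    · filter_upwards [eventually_lt_of_lt (f := fun η => p.2 + η) (g := fun _ => K.b i)
        (by fun_prop) (by fun_prop) (by simpa using (by linarith : p.2 < K.b i))] with η hη h'
      exact absurd h' hη.not_gt
    · filter_upwards [self_mem_nhdsWithin] with η hη _ h'
      have : 0 < η := hη
      linarith
  filter_upwards [h₁, h₂, h₃] with η h₁ h₂ h₃
  exact ⟨fun h => h₁ (by simp [h]), fun h => h₂ (by simp [h]), h₃⟩

/-- Few guards suffice for the free space of `k` rectangles. -/
theorem exists_guardsFreeSpace (hk : 1 ≤ k) (R : Fin k → IsoRect)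
    (hR : Pairwise fun i j => Disjoint (R i).carrier (R j).carrier) :
    ∃ G : Finset Guard, 5 * G.card ≤ 11 * k + 9 ∧ (∀ g ∈ G, g.IsVertexGuard R) ∧
      GuardsFreeSpace R G := by
  classical
  have : Nonempty (Fin k) := ⟨⟨0, hk⟩⟩
  have h₁ : ∃ᶠ δ in 𝓝[>] (0 : ℝ), ∃ G : Finset ((Fin k × Bool × Bool) × Direction), ∃ K,
      IsShrinking R δ K ∧ 5 * G.card ≤ 11 * k + 9 ∧
      ∀ c, K.IsCell c → ∃ g ∈ G, ∀ p ∈ c.carrier, (vertexGuard K.rect g).Sees K.rect p := by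
    refine Eventually.frequently ?_
    filter_upwards [eventually_exists_isShrinking R hR] with δ ⟨K, hK⟩
    obtain ⟨G, hG, hG'⟩ := K.exists_guards
    exact ⟨G, K, hK, by simpa using hG, hG'⟩
  -- Pigeonhole: finitely many sets `G` serve all small `δ`, so one of them serves arbitrarily small
  -- `δ`.
  obtain ⟨G, hG⟩ : ∃ G : Finset ((Fin k × Bool × Bool) × Direction), ∃ᶠ δ in 𝓝[>] (0 : ℝ), ∃ K,
      IsShrinking R δ K ∧ 5 * G.card ≤ 11 * k + 9 ∧
      ∀ c, K.IsCell c → ∃ g ∈ G, ∀ p ∈ c.carrier, (vertexGuard K.rect g).Sees K.rect p := by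
    by_contra h
    rw [not_exists] at h
    refine h₁ ((eventually_all.2 fun G => not_frequently.1 (h G)).mono fun δ hδ h' => ?_)
    obtain ⟨G, hG⟩ := h'
    exact hδ G hG
  refine ⟨G.image (vertexGuard R), ?_, ?_, fun p hp => ?_⟩
  · obtain ⟨δ, K, -, h, -⟩ := hG.exists
    have := Finset.card_image_le (s := G) (f := vertexGuard R)
    omega
  · intro g hg
    obtain ⟨g, -, rfl⟩ := Finset.mem_image.1 hg
    exact isVertexGuard_vertexGuard R g
  · by_contra! h
    -- If every guard misses `p`, then for small `δ` they all miss every point near `p`; but a point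
    -- just above `p` lies in a cell, which one of them sees.
    have h₂ : ∀ᶠ x in 𝓝 ((0 : ℝ), p), ∀ g ∈ G, ∀ K, IsShrinking R x.1 K →
        ¬ (vertexGuard K.rect g).Sees K.rect x.2 :=
      (Finset.eventually_all G).2 fun g hg =>
        eventually_not_sees R g (h _ (Finset.mem_image_of_mem _ hg))
    obtain ⟨ε, hε, hball⟩ := Metric.eventually_nhds_iff.1 h₂
    have hIoo : ∀ᶠ δ in 𝓝[>] (0 : ℝ), δ ∈ Set.Ioo 0 ε := Ioo_mem_nhdsGT hε
    obtain ⟨δ, ⟨K, hK, -, hcov⟩, hδε, hp₁, hp₂⟩ := (hG.and_eventually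
      (hIoo.and
        ((eventually_abs_lt_inv p.1).and (eventually_abs_lt_inv p.2)))).exists
    obtain ⟨η, hgen, hη, hηM⟩ := ((eventually_general R hp hδε.1 hK).and
      (hIoo.and (eventually_lt_of_lt (f := fun η => p.2 + η) (g := fun _ => δ⁻¹)
        (by fun_prop) (by fun_prop) (by simpa using (abs_lt.1 hp₂).2)))).exists
    have hM := hK.M_eq
    have h₃ := abs_lt.1 hp₁
    have h₄ := abs_lt.1 hp₂
    obtain ⟨c, hc, hcp₁, hcp₂, hcp₃, hcp₄⟩ := K.exists_isCell (x := p.1) (y := p.2 + η)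
      (by linarith) (by linarith) (by linarith [hη.1]) (by linarith) (fun i => (hgen i).1)
      (fun i => (hgen i).2.1) (fun i => (hgen i).2.2)
    obtain ⟨g, hg, hsees⟩ := hcov c hc
    refine hball (y := (δ, p.1, p.2 + η)) ?_ g hg K hK
      (hsees _ ⟨⟨hcp₁.le, hcp₂.le⟩, hcp₃.le, hcp₄.le⟩)
    simp only [Prod.dist_eq, Real.dist_eq, max_lt_iff]
    refine ⟨?_, ?_, ?_⟩
    · simpa [abs_of_pos hδε.1] using hδε.2
    · simpa using hε
    · simpa [abs_of_pos hη.1] using hη.2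

end FreeSpaceGuarding

theorem mainTheorem7 (k : ℕ) (hk : 1 ≤ k) (R : Fin k → FreeSpaceGuarding.IsoRect)
    (hR : Pairwise fun i j => Disjoint (R i).carrier (R j).carrier) :
    ∃ G : Finset FreeSpaceGuarding.Guard,
      G.card ≤ 2 * k + k / 4 + 4 ∧
      (∀ g ∈ G, g.IsVertexGuard R) ∧
      FreeSpaceGuarding.GuardsFreeSpace R G := by
  obtain ⟨G, hG, hG'⟩ := FreeSpaceGuarding.exists_guardsFreeSpace hk R hR
  -- Here `(k + 9)/5 ≤ (k - 3)/4 + 4 ≤ ⌊k/4⌋ + 4`.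
  exact ⟨G, by omega, hG'⟩
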